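/- Let $n$ be a positive integer, and let $\mathfrak{osp}(1|2n)$ be the complex Lie superalgebra generated by odd elements $B_i^+,B_i^-$ ($1\le i\le n$) subject to the relations $$\big[\{B_i^\xi,B_j^\eta\},B_l^\epsilon\big]=(\epsilon-\xi)\,\delta_{i,l}\,B_j^\eta+(\epsilon-\eta)\,\delta_{j,l}\,B_i^\xi$$ for all $i,j,l\in\{1,\dots,n\}$ and $\xi,\eta,\epsilon\in\{+,-\}$ (read as $\pm1$ in the coefficients), where $[\cdot,\cdot]$ and $\{\cdot,\cdot\}$ denote the superbracket of an even with an odd element and of two odd elements, respectively. Let $\mathfrak{osp}(1|2n)^+$ be the subalgebra generated by $B_1^+,\dots,B_n^+$, and let $U(\mathfrak{osp}(1|2n)^+)$ be its universal enveloping algebra. For $I=(i_1,\dots,i_k)$ with $1\le i_1<\cdots<i_k\le n$ put $$B_I^+:=\sum_{\sigma\in S_k}\operatorname{sgn}(\sigma)\,B^+_{i_{\sigma(1)}}\cdots B^+_{i_{\sigma(k)}}\in U(\mathfrak{osp}(1|2n)^+).$$ Let $\mathbb{Y}_n$ be the set of semistandard Young tableaux, of arbitrary shape (the empty one included), with entries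 in $\{1,\dots,n\}$. For $A\in\mathbb{Y}_n$ with columns $a_1,\dots,a_m$ from left to right, each read from top to bottom as a strictly increasing sequence, put $$B_A^+:=B_{a_m}^+\cdots B_{a_1}^+ ,$$ with $B_A^+=1$ for the empty tableau. Then the elements $B_A^+$, $A\in\mathbb{Y}_n$ (one for each tableau, so pairwise distinct), form a basis of the complex vector space $U(\mathfrak{osp}(1|2n)^+)$. -/

import Mathlib

noncomputable section

namespace Osp

/-- Labels of the generators: `(i, ε)` stands for `B_i^ε`, with `ε = 1` or `ε = -1`.
The indices `1, …, n` are represented by `Fin n`. -/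
abbrev Gen (n : ℕ) : Type := Fin n × ℤˣ

/-- The free nonassociative algebra on the generators; its product plays the role of the
superbracket. It has the nonassociative words in the generators as a basis. Every generator is odd,
so a word has the parity of its length. -/
abbrev Free (n : ℕ) : Type := FreeNonUnitalNonAssocAlgebra ℂ (Gen n)

/-- A nonassociative word as an element of the free nonassociative algebra. -/
def word {n : ℕ} (w : FreeMagma (Gen n)) : Free n :=
  MonoidAlgebra.ofMagma ℂ (FreeMagma (Gen n)) w

/-- The generator `B_i^ε` in the free nonassociative algebra. -/
def gen {n : ℕ} (i : Fin n) (ε : ℤˣ) : Free n :=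
  FreeNonUnitalNonAssocAlgebra.of ℂ (i, ε)

/-- The sign `(-1)^{|u||v|}` of two words. -/
def sign {n : ℕ} (u v : FreeMagma (Gen n)) : ℂ := (-1) ^ (u.length * v.length)

/-- The elements that vanish in `osp(1|2n)`: the axioms of a Lie superalgebra, on words, and the
structural relations of the generators. The superbracket of two odd elements is the anticommutator
`{·,·}`, that of an even with an odd element is the commutator `[·,·]`. -/
inductive IsRelator (n : ℕ) : Free n → Prop
  | skew (u v : FreeMagma (Gen n)) :
      IsRelator n (word u * word v + sign u v • (word v * word u))
  | jacobi (u v w : FreeMagma (Gen n)) :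
      IsRelator n (word u * (word v * word w) -
        ((word u * word v) * word w + sign u v • (word v * (word u * word w))))
  | triple (i j l : Fin n) (ξ η ε : ℤˣ) :
      IsRelator n ((gen i ξ * gen j η) * gen l ε -
        ((if i = l then (((ε : ℤ) - (ξ : ℤ) : ℤ) : ℂ) else 0) • gen j η +
         (if j = l then (((ε : ℤ) - (η : ℤ) : ℤ) : ℂ) else 0) • gen i ξ))

/-- The two-sided ideal generated by the relators. -/
def relIdeal (n : ℕ) : Submodule ℂ (Free n) :=
  sInf {J | (∀ r, IsRelator n r → r ∈ J) ∧ ∀ x ∈ J, ∀ y, y * x ∈ J ∧ x * y ∈ J}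

theorem mul_mem_relIdeal_left {n : ℕ} {x : Free n} (hx : x ∈ relIdeal n) (y : Free n) :
    y * x ∈ relIdeal n := by
  refine Submodule.mem_sInf.2 fun J hJ => (hJ.2 x ?_ y).1
  exact Submodule.mem_sInf.1 hx J hJ

theorem mul_mem_relIdeal_right {n : ℕ} {x : Free n} (hx : x ∈ relIdeal n) (y : Free n) :
    x * y ∈ relIdeal n := by
  refine Submodule.mem_sInf.2 fun J hJ => (hJ.2 x ?_ y).2
  exact Submodule.mem_sInf.1 hx J hJ

end Osp

/-- The Lie superalgebra `osp(1|2n)` over `ℂ`, defined by generators and relations: it is generated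
by the odd elements `B_i^+`, `B_i^-`, for `i = 1, …, n`, subject to
`[{B_i^ξ, B_j^η}, B_l^ε] = (ε - ξ) δ_{i,l} B_j^η + (ε - η) δ_{j,l} B_i^ξ`. -/
abbrev Osp (n : ℕ) : Type := Osp.Free n ⧸ Osp.relIdeal n

namespace Osp

/-- The map `y ↦ [x, y]` on `osp(1|2n)` for an element `x` of the free nonassociative algebra. -/
def mulQ {n : ℕ} (x : Free n) : Osp n →ₗ[ℂ] Osp n :=
  (relIdeal n).mapQ (relIdeal n) (LinearMap.mulLeft ℂ x) fun _ hz => mul_mem_relIdeal_left hz x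

theorem mulQ_mkQ {n : ℕ} (x y : Free n) :
    mulQ x ((relIdeal n).mkQ y) = (relIdeal n).mkQ (x * y) := rfl

/-- The superbracket of `osp(1|2n)`, induced by the product of the free nonassociative algebra. -/
def bracket (n : ℕ) : Osp n →ₗ[ℂ] Osp n →ₗ[ℂ] Osp n :=
  (relIdeal n).liftQ
    (LinearMap.mk₂ ℂ (fun x y => mulQ x y)
      (fun x x' y => by
        obtain ⟨y, rfl⟩ := (relIdeal n).mkQ_surjective y
        rw [mulQ_mkQ, mulQ_mkQ, mulQ_mkQ, add_mul, map_add])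
      (fun c x y => by
        obtain ⟨y, rfl⟩ := (relIdeal n).mkQ_surjective y
        rw [mulQ_mkQ, mulQ_mkQ, smul_mul_assoc, map_smul])
      (fun x => map_add (mulQ x))
      (fun c x => map_smul (mulQ x) c))
    (fun x hx => by
      refine LinearMap.mem_ker.2 (LinearMap.ext fun y => ?_)
      obtain ⟨y, rfl⟩ := (relIdeal n).mkQ_surjective y
      exact (Submodule.Quotient.mk_eq_zero _).2 (mul_mem_relIdeal_right hx y))

/-- The homogeneous part of `osp(1|2n)` of parity `a`: even for `a = 0` and odd for `a = 1`. -/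
def part (n : ℕ) (a : ZMod 2) : Submodule ℂ (Osp n) :=
  Submodule.span ℂ {x | ∃ w : FreeMagma (Gen n),
    (w.length : ZMod 2) = a ∧ x = (relIdeal n).mkQ (word w)}

/-- The creation generator `B_i^+` as an element of `osp(1|2n)`. -/
def create {n : ℕ} (i : Fin n) : Osp n := (relIdeal n).mkQ (gen i 1)

/-- The subalgebra `osp(1|2n)^+` of `osp(1|2n)` generated by `B_1^+, …, B_n^+`. -/
def creation (n : ℕ) : Submodule ℂ (Osp n) :=
  sInf {S | (∀ i, create i ∈ S) ∧ ∀ x ∈ S, ∀ y ∈ S, bracket n x y ∈ S}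

theorem create_mem {n : ℕ} (i : Fin n) : create i ∈ creation n :=
  Submodule.mem_sInf.2 fun _ hS => hS.1 i

theorem bracket_mem {n : ℕ} {x y : Osp n} (hx : x ∈ creation n) (hy : y ∈ creation n) :
    bracket n x y ∈ creation n :=
  Submodule.mem_sInf.2 fun S hS =>
    hS.2 x (Submodule.mem_sInf.1 hx S hS) y (Submodule.mem_sInf.1 hy S hS)

/-- The relations `x y = (-1)^{|x||y|} y x + [x, y]`, for homogeneous `x, y ∈ osp(1|2n)^+`, that
define the enveloping algebra as a quotient of the tensor algebra. -/
inductive EnvRel (n : ℕ) :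
    TensorAlgebra ℂ (creation n) → TensorAlgebra ℂ (creation n) → Prop
  | bracket (a b : ZMod 2) (x y : creation n)
      (hx : (x : Osp n) ∈ part n a) (hy : (y : Osp n) ∈ part n b) :
      EnvRel n (TensorAlgebra.ι ℂ x * TensorAlgebra.ι ℂ y)
        ((-1 : ℂ) ^ (a.val * b.val) • (TensorAlgebra.ι ℂ y * TensorAlgebra.ι ℂ x) +
          TensorAlgebra.ι ℂ ⟨Osp.bracket n x y, bracket_mem x.2 y.2⟩)

/-- The universal enveloping algebra `U(osp(1|2n)^+)` of the Lie superalgebra `osp(1|2n)^+`. -/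
def Env (n : ℕ) : Type := RingQuot (EnvRel n)

instance (n : ℕ) : Ring (Env n) := inferInstanceAs (Ring (RingQuot (EnvRel n)))

instance (n : ℕ) : Algebra ℂ (Env n) := inferInstanceAs (Algebra ℂ (RingQuot (EnvRel n)))

/-- The projection from the tensor algebra to the enveloping algebra. -/
def envMk (n : ℕ) : TensorAlgebra ℂ (creation n) →ₐ[ℂ] Env n := RingQuot.mkAlgHom ℂ (EnvRel n)

/-- The canonical map from `osp(1|2n)^+` to its enveloping algebra. -/
def toEnv (n : ℕ) : creation n →ₗ[ℂ] Env n :=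
  (envMk n).toLinearMap ∘ₗ TensorAlgebra.ι ℂ

/-- The generator `B_i^+` as an element of the enveloping algebra. -/
def B {n : ℕ} (i : Fin n) : Env n := toEnv n ⟨create i, create_mem i⟩

/-- `B_I^+ = ∑_{σ ∈ S_k} sgn(σ) B^+_{i_{σ(1)}} ⋯ B^+_{i_{σ(k)}}` for `I = (i_1, …, i_k)`. -/
def columnOp {n k : ℕ} (I : Fin k → Fin n) : Env n :=
  ∑ σ : Equiv.Perm (Fin k),
    (((Equiv.Perm.sign σ : ℤˣ) : ℤ) : ℂ) • (List.ofFn fun r : Fin k => B (I (σ r))).prod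

end Osp

/-- The set `𝕐_n` of semistandard Young tableaux of arbitrary shape with `n` possible entries. The
entries `1, …, n` are represented by `0, …, n - 1`, and rows and columns are numbered from `0`. -/
structure Tableau (n : ℕ) where
  /-- the shape `λ_A` -/
  shape : YoungDiagram
  /-- the semistandard filling of the shape -/
  filling : SemistandardYoungTableau shape
  /-- all entries lie in the alphabet -/
  entry_lt : ∀ i j, (i, j) ∈ shape → filling i j < n

namespace Tableau

variable {n : ℕ}

/-- The number of columns `m = ℓ(λ_A')`. -/
def numCols (A : Tableau n) : ℕ := A.shape.rowLen 0

/-- The `l`-th column `a_l`, counted from left to right and read from top to bottom. -/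
def column (A : Tableau n) (l : ℕ) : Fin (A.shape.colLen l) → Fin n :=
  fun r => ⟨A.filling r l, A.entry_lt r l (YoungDiagram.mem_iff_lt_colLen.2 r.2)⟩

/-- `B_A^+ = B^+_{a_m} ⋯ B^+_{a_1}`, with the leftmost column as the rightmost factor. -/
def op (A : Tableau n) : Osp.Env n :=
  ((List.range A.numCols).reverse.map fun l => Osp.columnOp (A.column l)).prod

end Tableau

end

/-! Spanning. In `U` the anticommutators `{B_i, B_j}` commute with every generator, and this is the
only relation needed. Multiplying the generators by anticommuting variables `θ_j` turns
anticommutators into commutators and antisymmetrized products into symmetrized ones. When all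
commutators are central, symmetrized products obey an exchange identity (`symProd_mul_symProd`). It
yields Garnir relations for two columns, modulo products whose right factor is longer
(`twoCol_mem_span`). Hence two neighbouring columns that violate semistandardness can be rewritten
so that weight moves to the left column (`colF_mul_colF_mem_span`), and this process terminates.
Since the `B_i` are one-box columns and generate `U` (`adjoin_range_B`), tableaux span.

Independence. In Green's ansatz `B_i^+` acts on polynomials in variables `x_{a,i}`, with `n` rows
`a`, as `∑_a x_{a,i} K_a`; the Klein operators `K_a` make different rows anticommute.
Antisymmetrizing a column kills every term with two letters in one row. Among the surviving terms
the lexicographically largest puts the `r`-th letter in row `r`. So `B_A^+ · 1` has as leading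
monomial the product of `x_{a,i}` over the cells of `A`, with row `a` and entry `i`
(`hasLead_rep_op`). A semistandard tableau is determined by the content of its rows
(`rowContent_injective`), so the leading monomials are distinct. -/

noncomputable section

/-! ### Superbrackets on pairs and homomorphisms out of the enveloping algebra -/

namespace Osp

/-- Pairs of an even and an odd element of an associative algebra, with the superbracket as
multiplication. -/
@[ext] structure SuperPair (A : Type*) where
  /-- the even component -/
  even : A
  /-- the odd component -/
  odd : A

namespace SuperPair

variable {A : Type*} [Ring A]

/-- The underlying pair. -/
def equivProd (A : Type*) : SuperPair A ≃ A × A where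
  toFun x := (x.even, x.odd)
  invFun x := ⟨x.1, x.2⟩
  left_inv _ := rfl
  right_inv _ := rfl

instance : AddCommGroup (SuperPair A) := (equivProd A).addCommGroup
instance [Algebra ℂ A] : Module ℂ (SuperPair A) := (equivProd A).module ℂ

@[simp] theorem even_zero : (0 : SuperPair A).even = 0 := rfl
@[simp] theorem odd_zero : (0 : SuperPair A).odd = 0 := rfl
@[simp] theorem even_add (x y : SuperPair A) : (x + y).even = x.even + y.even := rfl
@[simp] theorem odd_add (x y : SuperPair A) : (x + y).odd = x.odd + y.odd := rfl
@[simp] theorem even_sub (x y : SuperPair A) : (x - y).even = x.even - y.even := rfl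
@[simp] theorem odd_sub (x y : SuperPair A) : (x - y).odd = x.odd - y.odd := rfl
@[simp] theorem even_neg (x : SuperPair A) : (-x).even = -x.even := rfl
@[simp] theorem odd_neg (x : SuperPair A) : (-x).odd = -x.odd := rfl
@[simp] theorem even_smul [Algebra ℂ A] (c : ℂ) (x : SuperPair A) : (c • x).even = c • x.even := rfl
@[simp] theorem odd_smul [Algebra ℂ A] (c : ℂ) (x : SuperPair A) : (c • x).odd = c • x.odd := rfl

/-- No grading of `A` is assumed: the slot of the pair records the parity. Odd with odd gives an
anticommutator, every other combination a commutator. -/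
instance : Mul (SuperPair A) where
  mul x y := ⟨x.even * y.even - y.even * x.even + (x.odd * y.odd + y.odd * x.odd),
    x.even * y.odd - y.odd * x.even + (x.odd * y.even - y.even * x.odd)⟩

@[simp] theorem even_mul (x y : SuperPair A) : (x * y).even =
    x.even * y.even - y.even * x.even + (x.odd * y.odd + y.odd * x.odd) := rfl
@[simp] theorem odd_mul (x y : SuperPair A) : (x * y).odd =
    x.even * y.odd - y.odd * x.even + (x.odd * y.even - y.even * x.odd) := rfl

instance : NonUnitalNonAssocRing (SuperPair A) where
  left_distrib x y z := by ext <;> simp <;> noncomm_ring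
  right_distrib x y z := by ext <;> simp <;> noncomm_ring
  zero_mul x := by ext <;> simp
  mul_zero x := by ext <;> simp

variable [Algebra ℂ A]

instance : IsScalarTower ℂ (SuperPair A) (SuperPair A) where
  smul_assoc c x y := by ext <;> simp [smul_sub, smul_add]

instance : SMulCommClass ℂ (SuperPair A) (SuperPair A) where
  smul_comm c x y := by ext <;> simp [smul_sub, smul_add]

/-- The sum of the two components. -/
def total : SuperPair A →ₗ[ℂ] A where
  toFun x := x.even + x.odd
  map_add' x y := by simp; abel
  map_smul' c x := by simp

end SuperPair

variable {A : Type*} [Ring A] [Algebra ℂ A] {n : ℕ}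

/-- The relations between the generators of `osp(1|2n)`, for elements of an associative algebra. -/
def TripleRel (β : Gen n → A) : Prop :=
  ∀ (i j l : Fin n) (ξ η ε : ℤˣ),
    (β (i, ξ) * β (j, η) + β (j, η) * β (i, ξ)) * β (l, ε) -
      β (l, ε) * (β (i, ξ) * β (j, η) + β (j, η) * β (i, ξ)) =
    (if i = l then (((ε : ℤ) - (ξ : ℤ) : ℤ) : ℂ) else 0) • β (j, η) +
      (if j = l then (((ε : ℤ) - (η : ℤ) : ℤ) : ℂ) else 0) • β (i, ξ)

/-- The extension of an assignment of odd elements to the free nonassociative algebra. -/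
def freeLift (β : Gen n → A) : Free n →ₙₐ[ℂ] SuperPair A :=
  FreeNonUnitalNonAssocAlgebra.lift ℂ fun g => ⟨0, β g⟩

theorem freeLift_gen (β : Gen n → A) (i : Fin n) (ε : ℤˣ) :
    freeLift β (gen i ε) = ⟨0, β (i, ε)⟩ := by
  simp [freeLift, gen]

theorem word_mul (u v : FreeMagma (Gen n)) : word (u * v) = word u * word v :=
  map_mul (MonoidAlgebra.ofMagma ℂ (FreeMagma (Gen n))) u v

theorem word_of (i : Fin n) (ε : ℤˣ) : word (FreeMagma.of (i, ε)) = gen i ε := rfl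

/-- The signs in the skew-symmetry and Jacobi relators depend on parities, so checking them requires
each word to live in a single slot. -/
theorem freeLift_word (β : Gen n → A) (w : FreeMagma (Gen n)) :
    (Even w.length → (freeLift β (word w)).odd = 0) ∧
      (Odd w.length → (freeLift β (word w)).even = 0) := by
  induction w using FreeMagma.recOnMul with
  | ih1 x =>
    obtain ⟨i, ε⟩ := x
    rw [word_of, freeLift_gen]
    refine ⟨fun h => ?_, fun _ => rfl⟩
    exact absurd h (by simp [FreeMagma.length])
  | ih2 u v hu hv =>
    have hl : (u * v).length = u.length + v.length := rfl
    rw [word_mul, map_mul, hl]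
    rcases Nat.even_or_odd u.length with h1 | h1 <;> rcases Nat.even_or_odd v.length with h2 | h2
    · exact ⟨fun _ => by simp [hu.1 h1, hv.1 h2],
        fun h => absurd h (Nat.not_odd_iff_even.2 (h1.add h2))⟩
    · exact ⟨fun h => absurd h (Nat.not_even_iff_odd.2 (h1.add_odd h2)),
        fun _ => by simp [hu.1 h1, hv.2 h2]⟩
    · exact ⟨fun h => absurd h (Nat.not_even_iff_odd.2 (h1.add_even h2)),
        fun _ => by simp [hu.2 h1, hv.1 h2]⟩
    · exact ⟨fun _ => by simp [hu.2 h1, hv.2 h2],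
        fun h => absurd h (Nat.not_odd_iff_even.2 (h1.add_odd h2))⟩

theorem freeLift_relator {β : Gen n → A} (hβ : TripleRel β) {r : Free n} (hr : IsRelator n r) :
    freeLift β r = 0 := by
  cases hr with
  | skew u v =>
    rw [map_add, map_smul, map_mul, map_mul, sign]
    have hu := freeLift_word β u
    have hv := freeLift_word β v
    rcases Nat.even_or_odd u.length with h1 | h1 <;> rcases Nat.even_or_odd v.length with h2 | h2
    · rw [(h1.mul_right _).neg_one_pow]
      ext <;> simp [hu.1 h1, hv.1 h2]
    · rw [(h1.mul_right _).neg_one_pow]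
      ext <;> simp [hu.1 h1, hv.2 h2]
    · rw [(h2.mul_left _).neg_one_pow]
      ext <;> simp [hu.2 h1, hv.1 h2]
    · rw [(h1.mul h2).neg_one_pow]
      ext
      · simp [hu.2 h1, hv.2 h2]; abel
      · simp [hu.2 h1, hv.2 h2]
  | jacobi u v w =>
    simp only [map_sub, map_add, map_smul, map_mul, sign]
    have hu := freeLift_word β u
    have hv := freeLift_word β v
    have hw := freeLift_word β w
    rcases Nat.even_or_odd u.length with h1 | h1 <;> rcases Nat.even_or_odd v.length with h2 | h2
    · rw [(h1.mul_right _).neg_one_pow]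
      ext <;> simp [hu.1 h1, hv.1 h2] <;> noncomm_ring
    · rw [(h1.mul_right _).neg_one_pow]
      ext <;> simp [hu.1 h1, hv.2 h2] <;> noncomm_ring
    · rw [(h2.mul_left _).neg_one_pow]
      ext <;> simp [hu.2 h1, hv.1 h2] <;> noncomm_ring
    · rw [(h1.mul h2).neg_one_pow]
      ext <;> simp [hu.2 h1, hv.2 h2] <;> noncomm_ring
  | triple i j l ξ η ε =>
    simp only [map_sub, map_add, map_smul, map_mul, freeLift_gen]
    have h := hβ i j l ξ η ε
    ext
    · simp only [SuperPair.even_sub, SuperPair.even_add, SuperPair.even_smul, SuperPair.even_mul,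
        SuperPair.odd_mul]
      simp
    · simp only [SuperPair.odd_sub, SuperPair.odd_add, SuperPair.odd_smul, SuperPair.odd_mul,
        SuperPair.even_mul, SuperPair.odd_zero, ← h]
      noncomm_ring

theorem relIdeal_le_ker {β : Gen n → A} (hβ : TripleRel β) :
    relIdeal n ≤ LinearMap.ker (freeLift β : Free n →ₗ[ℂ] SuperPair A) := by
  refine sInf_le ⟨fun r hr => freeLift_relator hβ hr, fun x hx y => ?_⟩
  have hx' : freeLift β x = 0 := hx
  constructor <;> simp [hx']

/-- The map to the superbracket algebra of pairs induced on `osp(1|2n)`. -/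
def lift {β : Gen n → A} (hβ : TripleRel β) : Osp n →ₗ[ℂ] SuperPair A :=
  (relIdeal n).liftQ (freeLift β : Free n →ₗ[ℂ] SuperPair A) (relIdeal_le_ker hβ)

theorem lift_mkQ {β : Gen n → A} (hβ : TripleRel β) (x : Free n) :
    lift hβ ((relIdeal n).mkQ x) = freeLift β x := rfl

theorem bracket_mkQ (x y : Free n) :
    bracket n ((relIdeal n).mkQ x) ((relIdeal n).mkQ y) = (relIdeal n).mkQ (x * y) := rfl

theorem lift_bracket {β : Gen n → A} (hβ : TripleRel β) (x y : Osp n) :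
    lift hβ (bracket n x y) = lift hβ x * lift hβ y := by
  obtain ⟨x, rfl⟩ := (relIdeal n).mkQ_surjective x
  obtain ⟨y, rfl⟩ := (relIdeal n).mkQ_surjective y
  rw [bracket_mkQ, lift_mkQ, lift_mkQ, lift_mkQ, map_mul]

theorem lift_part_zero {β : Gen n → A} (hβ : TripleRel β) {x : Osp n} (hx : x ∈ part n 0) :
    (lift hβ x).odd = 0 := by
  induction hx using Submodule.span_induction with
  | mem x h =>
    obtain ⟨w, hw, rfl⟩ := h
    exact (freeLift_word β w).1 (ZMod.natCast_eq_zero_iff_even.1 hw)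
  | zero => simp
  | add x y _ _ hx hy => simp [hx, hy]
  | smul c x _ hx => simp [hx]

theorem lift_part_one {β : Gen n → A} (hβ : TripleRel β) {x : Osp n} (hx : x ∈ part n 1) :
    (lift hβ x).even = 0 := by
  induction hx using Submodule.span_induction with
  | mem x h =>
    obtain ⟨w, hw, rfl⟩ := h
    exact (freeLift_word β w).2 (ZMod.natCast_eq_one_iff_odd.1 hw)
  | zero => simp
  | add x y _ _ hx hy => simp [hx, hy]
  | smul c x _ hx => simp [hx]

/-- The linear map that underlies `envLift`. -/
def creationLift {β : Gen n → A} (hβ : TripleRel β) : creation n →ₗ[ℂ] A :=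
  SuperPair.total ∘ₗ lift hβ ∘ₗ (creation n).subtype

theorem creationLift_apply {β : Gen n → A} (hβ : TripleRel β) (x : creation n) :
    creationLift hβ x = (lift hβ x).even + (lift hβ x).odd := rfl

/-- Elements of an associative algebra that satisfy the relations of the generators define a
homomorphism from the enveloping algebra of `osp(1|2n)^+`. -/
def envLift {β : Gen n → A} (hβ : TripleRel β) : Env n →ₐ[ℂ] A :=
  -- `osp(1|2n)^+` is only known as a subalgebra of `osp(1|2n)`, so `β` must supply annihilation
  -- generators too, although only `β (i, 1)` survives in `envLift_B`.
  RingQuot.liftAlgHom ℂ (s := EnvRel n) ⟨TensorAlgebra.lift ℂ (creationLift hβ), by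
    intro x y h
    cases h with
    | bracket a b x y hx hy =>
      have ha : a = 0 ∨ a = 1 := (by decide : ∀ a : ZMod 2, a = 0 ∨ a = 1) a
      have hb : b = 0 ∨ b = 1 := (by decide : ∀ b : ZMod 2, b = 0 ∨ b = 1) b
      simp only [map_mul, map_add, map_smul, TensorAlgebra.lift_ι_apply, creationLift_apply,
        lift_bracket]
      rcases ha with rfl | rfl <;> rcases hb with rfl | rfl
      · simp [lift_part_zero hβ hx, lift_part_zero hβ hy]
      · simp [lift_part_zero hβ hx, lift_part_one hβ hy]
      · simp [lift_part_one hβ hx, lift_part_zero hβ hy]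
      · simp [lift_part_one hβ hx, lift_part_one hβ hy, ZMod.val_one]⟩

theorem envLift_B {β : Gen n → A} (hβ : TripleRel β) (i : Fin n) :
    envLift hβ (B i) = β (i, 1) := by
  have h : envLift hβ (B i) = TensorAlgebra.lift ℂ (creationLift hβ)
      (TensorAlgebra.ι ℂ (⟨create i, create_mem i⟩ : creation n)) :=
    RingQuot.liftAlgHom_mkAlgHom_apply ℂ _ _ _
  rw [h, TensorAlgebra.lift_ι_apply, creationLift_apply]
  have h2 : lift hβ (create i) = ⟨0, β (i, 1)⟩ := freeLift_gen β i 1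
  simp [h2]

/-! ### Generators and relations inside the enveloping algebra -/

theorem create_mem_part (i : Fin n) : create i ∈ part n 1 :=
  Submodule.subset_span ⟨FreeMagma.of (i, 1), by simp [FreeMagma.length], rfl⟩

theorem bracket_mem_part {a b : ZMod 2} {x y : Osp n} (hx : x ∈ part n a) (hy : y ∈ part n b) :
    bracket n x y ∈ part n (a + b) := by
  induction hx, hy using Submodule.span_induction₂ with
  | mem_mem x y hx hy =>
    obtain ⟨u, hu, rfl⟩ := hx
    obtain ⟨v, hv, rfl⟩ := hy
    refine Submodule.subset_span ⟨u * v, ?_, ?_⟩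
    · have hl : (u * v).length = u.length + v.length := rfl
      rw [hl, Nat.cast_add, hu, hv]
    · rw [bracket_mkQ, word_mul]
  | zero_left y hy => simp
  | zero_right x hx => simp
  | add_left x y z _ _ _ h1 h2 => simpa using add_mem h1 h2
  | add_right x y z _ _ _ h1 h2 => simpa using add_mem h1 h2
  | smul_left c x y _ _ h => simpa using Submodule.smul_mem _ c h
  | smul_right c x y _ _ h => simpa using Submodule.smul_mem _ c h

theorem toEnv_mul {a b : ZMod 2} (x y : creation n) (hx : (x : Osp n) ∈ part n a)
    (hy : (y : Osp n) ∈ part n b) :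
    toEnv n x * toEnv n y = (-1 : ℂ) ^ (a.val * b.val) • (toEnv n y * toEnv n x) +
      toEnv n ⟨bracket n x y, bracket_mem x.2 y.2⟩ := by
  have h := RingQuot.mkAlgHom_rel ℂ (EnvRel.bracket a b x y hx hy)
  rw [map_mul, map_add, map_smul, map_mul] at h
  exact h

theorem bracket_create_create_create (i j l : Fin n) :
    bracket n (bracket n (create i) (create j)) (create l) = 0 := by
  refine (Submodule.Quotient.mk_eq_zero _).2 ?_
  refine Submodule.mem_sInf.2 fun J hJ => ?_
  simpa using hJ.1 _ (IsRelator.triple i j l 1 1 1)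

/-- The anticommutator is the image of an even element, and the coefficients `ε - ξ`, `ε - η` of its
bracket with `B_l^+` vanish when all signs are `+`. -/
theorem commute_anticommutator_B (i j l : Fin n) :
    Commute (B i * B j + B j * B i) (B l) := by
  have hz : B i * B j + B j * B i = toEnv n ⟨bracket n (create i) (create j),
      bracket_mem (create_mem i) (create_mem j)⟩ := by
    have h := toEnv_mul (⟨create i, create_mem i⟩ : creation n) ⟨create j, create_mem j⟩
      (create_mem_part i) (create_mem_part j)
    simp only [ZMod.val_one, mul_one, pow_one, neg_smul, one_smul] at h
    rw [B, B, h]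
    abel
  have h := toEnv_mul (⟨bracket n (create i) (create j),
      bracket_mem (create_mem i) (create_mem j)⟩ : creation n) ⟨create l, create_mem l⟩
      (bracket_mem_part (create_mem_part i) (create_mem_part j)) (create_mem_part l)
  have h0 : toEnv n ⟨bracket n (bracket n (create i) (create j)) (create l),
      bracket_mem (bracket_mem (create_mem i) (create_mem j)) (create_mem l)⟩ = 0 := by
    rw [← map_zero (toEnv n)]
    congr 1
    exact Subtype.ext (bracket_create_create_create i j l)
  have h1 : ((1 : ZMod 2) + 1).val = 0 := by decide
  simp only [h0, h1, zero_mul, pow_zero, one_smul, add_zero] at h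
  rw [hz]
  exact h

/-- In `U` a bracket is expressed by products only for homogeneous arguments. The sum of the spaces
`S a` of suitable homogeneous elements contains the generators and is closed under the bracket,
hence contains `creation n`. -/
theorem exists_homogeneous_of_mem_creation {x : Osp n} (hx : x ∈ creation n) :
    ∃ y : ZMod 2 → creation n, (∀ a, (y a : Osp n) ∈ part n a ∧
      toEnv n (y a) ∈ Algebra.adjoin ℂ (Set.range (B : Fin n → Env n))) ∧
      x = ∑ a, (y a : Osp n) := by
  set R := Algebra.adjoin ℂ (Set.range (B : Fin n → Env n)) with hR
  let S (a : ZMod 2) : Submodule ℂ (Osp n) :=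
    ((part n a).comap (creation n).subtype ⊓ R.toSubmodule.comap (toEnv n)).map
      (creation n).subtype
  have hS : ∀ {a b : ZMod 2} {x y : Osp n}, x ∈ S a → y ∈ S b → bracket n x y ∈ S (a + b) := by
    rintro a b _ _ ⟨x, ⟨hx1, hx2⟩, rfl⟩ ⟨y, ⟨hy1, hy2⟩, rfl⟩
    refine ⟨⟨bracket n x y, bracket_mem x.2 y.2⟩, ⟨bracket_mem_part hx1 hy1, ?_⟩, rfl⟩
    have h := toEnv_mul x y hx1 hy1
    have h' := eq_sub_of_add_eq' h.symm
    change toEnv n _ ∈ R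
    rw [h']
    exact sub_mem (mul_mem hx2 hy2) (Subalgebra.smul_mem _ (mul_mem hy2 hx2) _)
  have hle : creation n ≤ ⨆ a, S a := by
    refine sInf_le ⟨fun i => ?_, fun x hx y hy => ?_⟩
    · refine Submodule.mem_iSup_of_mem 1 ⟨⟨create i, create_mem i⟩, ⟨create_mem_part i, ?_⟩, rfl⟩
      exact Algebra.subset_adjoin ⟨i, rfl⟩
    · induction hx using Submodule.iSup_induction' with
      | mem a x hx =>
        induction hy using Submodule.iSup_induction' with
        | mem b y hy => exact Submodule.mem_iSup_of_mem _ (hS hx hy)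
        | zero => simp
        | add y z _ _ h1 h2 => simpa using add_mem h1 h2
      | zero => simp
      | add x z _ _ h1 h2 => simpa using add_mem h1 h2
  obtain ⟨f, hf⟩ := (Submodule.mem_iSup_iff_exists_finsupp _ _).1 (hle hx)
  choose y hy hyf using hf.1
  refine ⟨y, hy, ?_⟩
  rw [← hf.2, Finsupp.sum_fintype _ _ (fun _ => rfl)]
  exact Finset.sum_congr rfl fun a _ => (hyf a).symm

theorem toEnv_mem_adjoin (x : creation n) :
    toEnv n x ∈ Algebra.adjoin ℂ (Set.range (B : Fin n → Env n)) := by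
  obtain ⟨y, hy, hx⟩ := exists_homogeneous_of_mem_creation x.2
  have : x = ∑ a, y a := Subtype.ext (by rw [hx]; simp)
  rw [this, map_sum]
  exact sum_mem fun a _ => (hy a).2

theorem adjoin_range_B (n : ℕ) : Algebra.adjoin ℂ (Set.range (B : Fin n → Env n)) = ⊤ := by
  refine top_unique fun x _ => ?_
  obtain ⟨t, rfl⟩ : ∃ t, envMk n t = x := RingQuot.mkAlgHom_surjective ℂ (EnvRel n) x
  induction t using TensorAlgebra.induction with
  | algebraMap r => simp
  | ι x => exact toEnv_mem_adjoin x
  | mul a b ha hb => rw [map_mul]; exact mul_mem (ha trivial) (hb trivial)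
  | add a b ha hb => rw [map_add]; exact add_mem (ha trivial) (hb trivial)

end Osp

/-! ### Symmetrized products of elements with central commutators -/

section SymmetrizedProduct

variable {ι T : Type*} [DecidableEq ι] [Ring T] [Algebra ℂ T]

theorem Finset.sum_erase_comm {M : Type*} [AddCommMonoid M] (J : Finset ι) (f : ι → ι → M) :
    ∑ j ∈ J, ∑ j' ∈ J.erase j, f j j' = ∑ j' ∈ J, ∑ j ∈ J.erase j', f j j' := by
  refine Finset.sum_comm' fun x y => ?_
  simp only [Finset.mem_erase]
  tauto

/-- The auxiliary recursion for `symProd`, on the number of factors. -/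
def symProdAux (t : ι → T) : ℕ → Finset ι → T
  | 0, _ => 1
  | k + 1, J => ((k + 1 : ℕ) : ℂ)⁻¹ • ∑ j ∈ J, t j * symProdAux t k (J.erase j)

/-- The symmetrized product of the elements `t j`, for `j ∈ J`: the sum of their products in all
possible orders, divided by the factorial of the number of factors. -/
def symProd (t : ι → T) (J : Finset ι) : T := symProdAux t J.card J

variable (t : ι → T)

@[simp] theorem symProd_empty : symProd t ∅ = 1 := rfl

theorem card_smul_symProd (J : Finset ι) :
    (J.card : ℂ) • symProd t J = ∑ j ∈ J, t j * symProd t (J.erase j) := by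
  rcases hk : J.card with _ | k
  · rw [Finset.card_eq_zero] at hk
    simp [hk]
  · have h : symProd t J = ((k + 1 : ℕ) : ℂ)⁻¹ • ∑ j ∈ J, t j * symProdAux t k (J.erase j) := by
      rw [symProd, hk, symProdAux]
    rw [h, smul_smul, mul_inv_cancel₀ (Nat.cast_ne_zero.2 k.succ_ne_zero), one_smul]
    refine Finset.sum_congr rfl fun j hj => ?_
    rw [symProd, Finset.card_erase_of_mem hj, hk, Nat.add_sub_cancel]

theorem Commute.symProd {x : T} (hx : ∀ i, Commute x (t i)) (J : Finset ι) :
    Commute x (symProd t J) := by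
  unfold _root_.symProd
  generalize J.card = k
  induction k generalizing J with
  | zero => exact Commute.one_right x
  | succ k ih =>
    refine Commute.smul_right (Commute.sum_right _ _ _ fun j _ => ?_) _
    exact (hx j).mul_right (ih _)

variable {t} (ht : ∀ i j l, Commute (t i * t j - t j * t i) (t l))
include ht

/-- Bracketing with `t i` is a derivation, and by `ht` each commutator it creates can be pulled to
the front of the product. -/
theorem mul_symProd_sub (i : ι) (J : Finset ι) :
    t i * symProd t J - symProd t J * t i =
      ∑ j ∈ J, (t i * t j - t j * t i) * symProd t (J.erase j) := by
  induction hk : J.card generalizing J with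
  | zero =>
    rw [Finset.card_eq_zero] at hk
    simp [hk]
  | succ k ih =>
    have hk0 : (J.card : ℂ) ≠ 0 := by rw [hk]; exact Nat.cast_ne_zero.2 k.succ_ne_zero
    apply smul_right_injective T hk0
    simp only
    rw [smul_sub, ← mul_smul_comm, ← smul_mul_assoc, card_smul_symProd, Finset.mul_sum,
      Finset.sum_mul, ← Finset.sum_sub_distrib]
    have h1 : ∀ j ∈ J, t i * (t j * symProd t (J.erase j)) - t j * symProd t (J.erase j) * t i =
        (t i * t j - t j * t i) * symProd t (J.erase j) +
        ∑ j' ∈ J.erase j, (t i * t j' - t j' * t i) *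
          (t j * symProd t ((J.erase j').erase j)) := by
      intro j hj
      have h2 := ih (J.erase j) (by rw [Finset.card_erase_of_mem hj, hk, Nat.add_sub_cancel])
      have h3 : t i * (t j * symProd t (J.erase j)) - t j * symProd t (J.erase j) * t i =
        (t i * t j - t j * t i) * symProd t (J.erase j) +
        t j * (t i * symProd t (J.erase j) - symProd t (J.erase j) * t i) := by noncomm_ring
      rw [h3, h2, Finset.mul_sum]
      congr 1
      refine Finset.sum_congr rfl fun j' _ => ?_
      rw [← mul_assoc, ← mul_assoc, (ht i j' j).eq, Finset.erase_right_comm]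
    rw [Finset.sum_congr rfl h1, Finset.sum_add_distrib, Finset.sum_erase_comm]
    -- Grouped by the factor `j'` that is hit, the other `k` factors reassemble into `k` copies of
    -- one symmetrized product.
    have h4 : ∀ j' ∈ J, ∑ j ∈ J.erase j', (t i * t j' - t j' * t i) *
          (t j * symProd t ((J.erase j').erase j)) =
          (k : ℂ) • ((t i * t j' - t j' * t i) * symProd t (J.erase j')) := by
      intro j' hj'
      rw [← Finset.mul_sum, ← card_smul_symProd, Finset.card_erase_of_mem hj', hk,
        Nat.add_sub_cancel, mul_smul_comm]
    rw [Finset.sum_congr rfl h4, ← Finset.smul_sum, hk]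
    push_cast
    rw [add_smul, one_smul, add_comm]

/-- The recursion that splits off the last factor instead of the first. The difference is a sum over
ordered pairs of an antisymmetric expression, so it vanishes. -/
theorem sum_symProd_mul (J : Finset ι) :
    ∑ j ∈ J, symProd t (J.erase j) * t j = (J.card : ℂ) • symProd t J := by
  have h1 : ∀ j ∈ J, symProd t (J.erase j) * t j = t j * symProd t (J.erase j) -
      ∑ j' ∈ J.erase j, (t j * t j' - t j' * t j) * symProd t ((J.erase j).erase j') := by
    intro j _
    rw [← mul_symProd_sub ht]
    abel
  rw [Finset.sum_congr rfl h1, Finset.sum_sub_distrib, ← card_smul_symProd, sub_eq_self]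
  set X := ∑ j ∈ J, ∑ j' ∈ J.erase j,
    (t j * t j' - t j' * t j) * symProd t ((J.erase j).erase j') with hX
  have h2 : X = -X := by
    conv_lhs => rw [hX, Finset.sum_erase_comm]
    rw [hX, ← Finset.sum_neg_distrib]
    refine Finset.sum_congr rfl fun j _ => ?_
    rw [← Finset.sum_neg_distrib]
    refine Finset.sum_congr rfl fun j' _ => ?_
    rw [Finset.erase_right_comm]
    noncomm_ring
  have h3 : (2 : ℂ) • X = 0 := by rw [two_smul]; nth_rw 1 [h2]; exact neg_add_cancel X
  exact (smul_eq_zero.1 h3).resolve_left two_ne_zero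

/-- With central commutators, the average over all positions of `t i` equals the average of the two
extreme positions. -/
theorem two_smul_symProd_insert {i : ι} {J : Finset ι} (hi : i ∉ J) :
    (2 : ℂ) • symProd t (insert i J) = t i * symProd t J + symProd t J * t i := by
  induction hk : J.card generalizing J with
  | zero =>
    rw [Finset.card_eq_zero] at hk
    subst hk
    have h := card_smul_symProd t (insert i ∅)
    simp only [Finset.card_insert_of_notMem hi, Finset.sum_insert hi] at h
    simp at h
    simp [h, two_smul]
  | succ k ih =>
    have hk0 : ((insert i J).card : ℂ) ≠ 0 := by
      rw [Finset.card_insert_of_notMem hi]; exact Nat.cast_ne_zero.2 J.card.succ_ne_zero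
    apply smul_right_injective T hk0
    simp only
    rw [smul_comm, card_smul_symProd, Finset.sum_insert hi, Finset.erase_insert hi, smul_add,
      Finset.smul_sum]
    have h1 : ∀ j ∈ J, (2 : ℂ) • (t j * symProd t ((insert i J).erase j)) =
        t i * (t j * symProd t (J.erase j)) + t j * symProd t (J.erase j) * t i -
          (t i * t j - t j * t i) * symProd t (J.erase j) := by
      intro j hj
      have hij : i ≠ j := fun h => hi (h ▸ hj)
      have h2 := ih (J := J.erase j) (fun h => hi (Finset.mem_of_mem_erase h))
        (by rw [Finset.card_erase_of_mem hj, hk, Nat.add_sub_cancel])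
      rw [← mul_smul_comm, Finset.erase_insert_of_ne hij, h2]
      noncomm_ring
    rw [Finset.sum_congr rfl h1, Finset.sum_sub_distrib, Finset.sum_add_distrib, ← Finset.mul_sum,
      ← Finset.sum_mul, ← card_smul_symProd, ← mul_symProd_sub ht, Finset.card_insert_of_notMem hi]
    push_cast
    rw [add_smul, one_smul, two_smul, mul_smul_comm, smul_mul_assoc, smul_add]
    abel

/-- Write `symProd t (insert i J)` as `t i * symProd t J` and `symProd t (insert j I)` as `symProd t
I * t j`, each minus half a sum of commutator terms. The two double sums of commutators cancel, and
the main terms count `|I|` and `|J|` copies of the product. -/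
theorem symProd_mul_symProd {I J : Finset ι} (hIJ : Disjoint I J) :
    ((I.card : ℂ) - J.card) • (symProd t I * symProd t J) =
      ∑ i ∈ I, symProd t (I.erase i) * symProd t (insert i J) -
        ∑ j ∈ J, symProd t (insert j I) * symProd t (J.erase j) := by
  apply smul_right_injective T (two_ne_zero (α := ℂ))
  simp only
  rw [smul_sub, Finset.smul_sum, Finset.smul_sum]
  have h1 : ∀ i ∈ I, (2 : ℂ) • (symProd t (I.erase i) * symProd t (insert i J)) =
      (2 : ℂ) • (symProd t (I.erase i) * t i * symProd t J) -
      ∑ j ∈ J, (t i * t j - t j * t i) * symProd t (I.erase i) * symProd t (J.erase j) := by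
    intro i hi
    have h2 : symProd t J * t i = t i * symProd t J -
      ∑ j ∈ J, (t i * t j - t j * t i) * symProd t (J.erase j) := by
      rw [← mul_symProd_sub ht]; abel
    rw [← mul_smul_comm, two_smul_symProd_insert ht (Finset.disjoint_left.1 hIJ hi), h2, mul_add,
      mul_sub, Finset.mul_sum, two_smul, ← mul_assoc, add_sub_assoc]
    congr 2
    refine Finset.sum_congr rfl fun j _ => ?_
    rw [← mul_assoc, (Commute.symProd t (ht i j) (I.erase i)).eq]
  have h3 : ∀ j ∈ J, (2 : ℂ) • (symProd t (insert j I) * symProd t (J.erase j)) =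
      (2 : ℂ) • (symProd t I * (t j * symProd t (J.erase j))) -
      ∑ i ∈ I, (t i * t j - t j * t i) * symProd t (I.erase i) * symProd t (J.erase j) := by
    intro j hj
    have h2 : t j * symProd t I = symProd t I * t j -
      ∑ i ∈ I, (t i * t j - t j * t i) * symProd t (I.erase i) := by
      have h4 : ∑ i ∈ I, (t i * t j - t j * t i) * symProd t (I.erase i) =
          - ∑ i ∈ I, (t j * t i - t i * t j) * symProd t (I.erase i) := by
        rw [← Finset.sum_neg_distrib]
        refine Finset.sum_congr rfl fun i _ => by noncomm_ring
      rw [h4, ← mul_symProd_sub ht]; abel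
    rw [← smul_mul_assoc, two_smul_symProd_insert ht (Finset.disjoint_right.1 hIJ hj), h2, add_mul,
      sub_mul, Finset.sum_mul, two_smul, ← mul_assoc]
    abel
  rw [Finset.sum_congr rfl h1, Finset.sum_congr rfl h3, Finset.sum_sub_distrib,
    Finset.sum_sub_distrib, ← Finset.smul_sum, ← Finset.smul_sum, ← Finset.sum_mul,
    ← Finset.mul_sum, sum_symProd_mul ht, ← card_smul_symProd, smul_mul_assoc, mul_smul_comm,
    Finset.sum_comm (s := J), sub_sub_sub_cancel_right, sub_smul, smul_sub]

/-- Moving one factor between two symmetrized products. -/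
theorem sum_symProd_compl_mul [Fintype ι] (J : Finset ι) :
    ((Jᶜ.card : ℂ) - J.card) • (symProd t Jᶜ * symProd t J) =
      ∑ i ∈ Jᶜ, symProd t (insert i J)ᶜ * symProd t (insert i J) -
        ∑ j ∈ J, symProd t (J.erase j)ᶜ * symProd t (J.erase j) := by
  rw [symProd_mul_symProd ht disjoint_compl_left]
  simp only [Finset.compl_insert, Finset.compl_erase]

end SymmetrizedProduct

/-! ### Garnir relations from single exchanges -/

section Garnir

variable {ι M : Type*} [DecidableEq ι] [AddCommGroup M]

theorem Finset.sum_powersetCard_succ_sum_erase (W : Finset ι) (q : ℕ) (f : Finset ι → M) :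
    ∑ Q ∈ W.powersetCard (q + 1), ∑ j ∈ Q, f (Q.erase j) =
      (W.card - q) • ∑ Q ∈ W.powersetCard q, f Q := by
  have h : (W.card - q) • ∑ Q ∈ W.powersetCard q, f Q =
      ∑ Q ∈ W.powersetCard q, ∑ j ∈ W \ Q, f Q := by
    rw [Finset.smul_sum]
    refine Finset.sum_congr rfl fun Q hQ => ?_
    rw [Finset.mem_powersetCard] at hQ
    rw [Finset.sum_const, Finset.card_sdiff_of_subset hQ.1, hQ.2]
  rw [h, Finset.sum_sigma', Finset.sum_sigma']
  refine Finset.sum_bij' (fun x _ => ⟨x.1.erase x.2, x.2⟩) (fun x _ => ⟨insert x.2 x.1, x.2⟩)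
    ?_ ?_ ?_ ?_ ?_
  · rintro ⟨Q, j⟩ hx
    simp only [Finset.mem_sigma, Finset.mem_powersetCard, Finset.mem_sdiff, Finset.mem_erase] at hx ⊢
    refine ⟨⟨(Finset.erase_subset _ _).trans hx.1.1, ?_⟩, hx.1.1 hx.2, by simp⟩
    rw [Finset.card_erase_of_mem hx.2, hx.1.2, Nat.add_sub_cancel]
  · rintro ⟨Q, j⟩ hx
    simp only [Finset.mem_sigma, Finset.mem_powersetCard, Finset.mem_sdiff] at hx ⊢
    refine ⟨⟨Finset.insert_subset hx.2.1 hx.1.1, ?_⟩, Finset.mem_insert_self _ _⟩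
    rw [Finset.card_insert_of_notMem hx.2.2, hx.1.2]
  · rintro ⟨Q, j⟩ hx
    simp only [Finset.mem_sigma] at hx
    simp [Finset.insert_erase hx.2]
  · rintro ⟨Q, j⟩ hx
    simp only [Finset.mem_sigma, Finset.mem_sdiff] at hx
    simp [Finset.erase_insert hx.2.2]
  · rintro ⟨Q, j⟩ _
    rfl

variable [Module ℂ M]

/-- The Garnir relations follow from the relations that move a single element. -/
theorem sum_powersetCard_union_mem (V : Submodule ℂ M) (c : Finset ι → M) (l : ℕ)
    (hc : ∀ J : Finset ι, J.card = l + 1 → ∑ j ∈ J, c (J.erase j) ∈ V)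
    (W : Finset ι) (hW : l < W.card) (R : Finset ι) (hRW : Disjoint W R) (hR : R.card ≤ l) :
    ∑ Q ∈ W.powersetCard (l - R.card), c (Q ∪ R) ∈ V := by
  induction hr : R.card generalizing R with
  | zero =>
    -- Summed over all `(l + 1)`-subsets of `W`, the given relations meet each `l`-subset `|W| - l`
    -- times.
    rw [Finset.card_eq_zero] at hr
    subst hr
    have h := Finset.sum_powersetCard_succ_sum_erase W l c
    have h1 : ∑ Q ∈ W.powersetCard (l + 1), ∑ j ∈ Q, c (Q.erase j) ∈ V :=
      sum_mem fun Q hQ => hc Q (Finset.mem_powersetCard.1 hQ).2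
    rw [h, ← Nat.cast_smul_eq_nsmul ℂ] at h1
    simpa using (Submodule.smul_mem_iff V
      (Nat.cast_ne_zero.2 (Nat.sub_ne_zero_of_lt hW))).1 h1
  | succ r ih =>
    set q := l - (r + 1) with hq
    have hq1 : l - r = q + 1 := by omega
    -- In the relation for `Q ∪ R`, erasing from `Q` produces the wanted sum `|W| - q` times, while
    -- erasing from `R` is covered by induction.
    have h1 : ∑ Q ∈ W.powersetCard (q + 1), ∑ j ∈ Q ∪ R, c ((Q ∪ R).erase j) ∈ V := by
      refine sum_mem fun Q hQ => hc _ ?_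
      rw [Finset.mem_powersetCard] at hQ
      rw [Finset.card_union_of_disjoint (hRW.mono_left hQ.1), hQ.2, hr]
      omega
    have h2 : ∀ Q ∈ W.powersetCard (q + 1), ∑ j ∈ Q ∪ R, c ((Q ∪ R).erase j) =
        ∑ j ∈ Q, c (Q.erase j ∪ R) + ∑ j ∈ R, c (Q ∪ R.erase j) := by
      intro Q hQ
      have hd := hRW.mono_left (Finset.mem_powersetCard.1 hQ).1
      rw [Finset.sum_union hd]
      congr 1
      · refine Finset.sum_congr rfl fun j hj => ?_
        rw [Finset.erase_union_distrib, Finset.erase_eq_of_notMem (Finset.disjoint_left.1 hd hj)]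
      · refine Finset.sum_congr rfl fun j hj => ?_
        rw [Finset.erase_union_distrib, Finset.erase_eq_of_notMem (s := Q)
          (Finset.disjoint_right.1 hd hj)]
    rw [Finset.sum_congr rfl h2, Finset.sum_add_distrib,
      Finset.sum_powersetCard_succ_sum_erase W q (fun Q => c (Q ∪ R)), Finset.sum_comm] at h1
    have h3 : ∑ j ∈ R, ∑ Q ∈ W.powersetCard (q + 1), c (Q ∪ R.erase j) ∈ V := by
      refine sum_mem fun j hj => ?_
      have hj' : (R.erase j).card = r := by
        rw [Finset.card_erase_of_mem hj, hr, Nat.add_sub_cancel]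
      have := ih (R.erase j) (hRW.mono_right (Finset.erase_subset _ _)) (by omega) hj'
      rwa [hq1] at this
    have h4 := (Submodule.add_mem_iff_left V h3).1 h1
    rw [← Nat.cast_smul_eq_nsmul ℂ] at h4
    exact (Submodule.smul_mem_iff V (Nat.cast_ne_zero.2 (by omega))).1 h4

end Garnir

/-! ### Column operators as alternating maps -/

namespace Osp

open scoped TensorProduct

variable {n : ℕ}

/-- The alternating map on an algebra that antisymmetrizes the product of `k` factors. -/
def antisymProd (A : Type*) [Ring A] [Algebra ℂ A] (k : ℕ) : A [⋀^Fin k]→ₗ[ℂ] A :=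
  MultilinearMap.alternatization (MultilinearMap.mkPiAlgebraFin ℂ k A)

theorem antisymProd_apply {A : Type*} [Ring A] [Algebra ℂ A] {k : ℕ} (v : Fin k → A) :
    antisymProd A k v = ∑ σ : Equiv.Perm (Fin k),
      (((Equiv.Perm.sign σ : ℤˣ) : ℤ) : ℂ) • (List.ofFn fun r : Fin k => v (σ r)).prod := by
  rw [antisymProd, MultilinearMap.alternatization_apply]
  refine Finset.sum_congr rfl fun σ _ => ?_
  rw [Units.smul_def, Int.cast_smul_eq_zsmul]
  rfl

theorem columnOp_eq {k : ℕ} (I : Fin k → Fin n) :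
    columnOp I = antisymProd (Env n) k fun r => B (I r) := by
  rw [antisymProd_apply]
  rfl

theorem columnOp_comp_perm {k : ℕ} (I : Fin k → Fin n) (σ : Equiv.Perm (Fin k)) :
    columnOp (I ∘ σ) = (((Equiv.Perm.sign σ : ℤˣ) : ℤ) : ℂ) • columnOp I := by
  rw [columnOp_eq, columnOp_eq, Int.cast_smul_eq_zsmul, ← Units.smul_def,
    ← AlternatingMap.map_perm]
  rfl

theorem columnOp_of_not_injective {k : ℕ} {I : Fin k → Fin n} (hI : ¬ Function.Injective I) :
    columnOp I = 0 := by
  simp only [Function.Injective, not_forall] at hI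
  obtain ⟨a, b, h, hab⟩ := hI
  rw [columnOp_eq]
  exact (antisymProd (Env n) k).map_eq_zero_of_eq _ (by simp only [h]) hab

/-- The column operator of a set of entries. -/
def colF (I : Finset (Fin n)) : Env n := columnOp (I.orderEmbOfFin rfl)

theorem columnOp_orderEmbOfFin {k : ℕ} (I : Finset (Fin n)) (h : I.card = k) :
    columnOp (I.orderEmbOfFin h) = colF I := by
  subst h; rfl

theorem columnOp_of_strictMono {k : ℕ} {I : Fin k → Fin n} (hI : StrictMono I) :
    columnOp I = colF (Finset.univ.image I) := by
  have hc : (Finset.univ.image I).card = k := by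
    rw [Finset.card_image_of_injective _ hI.injective, Finset.card_fin]
  rw [← columnOp_orderEmbOfFin _ hc]
  congr 1
  exact Finset.orderEmbOfFin_unique hc (fun x => Finset.mem_image_of_mem _ (Finset.mem_univ x)) hI

theorem exists_columnOp_eq_smul {k : ℕ} {I : Fin k → Fin n} (hI : Function.Injective I) :
    ∃ c : ℂ, c ≠ 0 ∧ columnOp I = c • colF (Finset.univ.image I) := by
  have hc : (Finset.univ.image I).card = k := by
    rw [Finset.card_image_of_injective _ hI, Finset.card_fin]
  set e := (Finset.univ.image I).orderEmbOfFin hc with he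
  have hr : ∀ i, ∃ j, e j = I i := by
    intro i
    have : I i ∈ Set.range e := by
      rw [he, Finset.range_orderEmbOfFin]
      simp
    exact this
  choose f hf using hr
  have hfi : Function.Injective f := fun a b hab => hI (by rw [← hf, ← hf, hab])
  set σ : Equiv.Perm (Fin k) := Equiv.ofBijective f (Finite.injective_iff_bijective.1 hfi) with hσ
  have h : I = e ∘ σ := funext fun i => (hf i).symm
  refine ⟨(((Equiv.Perm.sign σ : ℤˣ) : ℤ) : ℂ), ?_, ?_⟩
  · exact_mod_cast (Equiv.Perm.sign σ).ne_zero
  · conv_lhs => rw [h]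
    rw [columnOp_comp_perm, columnOp_orderEmbOfFin]

theorem colF_empty : colF (∅ : Finset (Fin n)) = 1 := by
  have h : columnOp (Fin.elim0 : Fin 0 → Fin n) = 1 := by simp [columnOp]
  rw [← h, columnOp_of_strictMono (fun a => a.elim0)]
  rfl

theorem colF_singleton (i : Fin n) : colF {i} = B i := by
  have h : columnOp (fun _ : Fin 1 => i) = B i := by simp [columnOp]
  rw [← h, columnOp_of_strictMono (Subsingleton.strictMono _)]
  congr 1

/-! ### Column operators as symmetrized products -/

section Anticommuting

variable {ι : Type*} [DecidableEq ι]

/-- Permutations are sorted by their value `p` at `0`, the index of the first factor, which matches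
the recursion of `symProd`. -/
theorem sum_perm_prod_eq_symProd {T : Type*} [Ring T] [Algebra ℂ T] (t : ι → T) {k : ℕ}
    (e : Fin k → ι) (he : Function.Injective e) :
    ∑ σ : Equiv.Perm (Fin k), (List.ofFn fun r => t (e (σ r))).prod =
      (k.factorial : ℂ) • symProd t (Finset.univ.image e) := by
  induction k with
  | zero =>
    simp
  | succ k ih =>
    rw [← Equiv.sum_comp (Equiv.Perm.decomposeFin (n := k)).symm, Fintype.sum_prod_type]
    have h1 : ∀ p : Fin (k + 1), ∑ τ : Equiv.Perm (Fin k),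
        (List.ofFn fun r => t (e (Equiv.Perm.decomposeFin.symm (p, τ) r))).prod =
        (k.factorial : ℂ) • (t (e p) * symProd t ((Finset.univ.image e).erase (e p))) := by
      intro p
      have h2 := ih (fun r => e (Equiv.swap 0 p r.succ))
        (he.comp ((Equiv.swap 0 p).injective.comp (Fin.succ_injective k)))
      have h3 : (Finset.univ.image fun r : Fin k => e (Equiv.swap 0 p r.succ)) =
          (Finset.univ.image e).erase (e p) := by
        rw [← Finset.image_erase he]
        have h4 : (Finset.univ.erase p : Finset (Fin (k + 1))) =
            Finset.univ.image fun r : Fin k => Equiv.swap 0 p r.succ := by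
          ext q
          simp only [Finset.mem_erase, Finset.mem_univ, and_true, Finset.mem_image, true_and]
          constructor
          · intro hq
            have h0 : Equiv.swap 0 p q ≠ 0 := by
              intro h
              rw [Equiv.swap_apply_eq_iff, Equiv.swap_apply_left] at h
              exact hq h
            obtain ⟨r, hr⟩ := Fin.exists_succ_eq.2 h0
            exact ⟨r, by rw [hr, Equiv.swap_apply_self]⟩
          · rintro ⟨r, rfl⟩ h
            rw [Equiv.swap_apply_eq_iff, Equiv.swap_apply_right] at h
            exact Fin.succ_ne_zero r h
        rw [h4, Finset.image_image]
        rfl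
      rw [← h3, ← mul_smul_comm, ← h2, Finset.mul_sum]
      refine Finset.sum_congr rfl fun τ _ => ?_
      rw [List.ofFn_succ, List.prod_cons, Equiv.Perm.decomposeFin_symm_apply_zero]
      simp only [Equiv.Perm.decomposeFin_symm_apply_succ]
    rw [Finset.sum_congr rfl fun p _ => h1 p, ← Finset.smul_sum,
      ← Finset.sum_image (f := fun j => t j * symProd t ((Finset.univ.image e).erase j))
        (g := e) (fun _ _ _ _ h => he h), ← card_smul_symProd,
      Finset.card_image_of_injective _ he, Finset.card_fin, smul_smul, Nat.factorial_succ]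
    push_cast
    rw [mul_comm]

theorem prod_ofFn_tmul {A C : Type*} [Ring A] [Algebra ℂ A] [Ring C] [Algebra ℂ C] {k : ℕ}
    (x : Fin k → A) (y : Fin k → C) :
    (List.ofFn fun r => x r ⊗ₜ[ℂ] y r).prod = (List.ofFn x).prod ⊗ₜ[ℂ] (List.ofFn y).prod := by
  induction k with
  | zero => rfl
  | succ k ih =>
    simp only [List.ofFn_succ, List.prod_cons, ih, Algebra.TensorProduct.tmul_mul_tmul]

/-- The anticommuting variables. -/
def theta (j : ι) : ExteriorAlgebra ℂ (ι → ℂ) := ExteriorAlgebra.ι ℂ (Pi.single j 1)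

theorem theta_mul_theta (i j : ι) : theta i * theta j = -(theta j * theta i) :=
  eq_neg_of_add_eq_zero_left (ExteriorAlgebra.ι_add_mul_swap _ _)

/-- The generators, multiplied with anticommuting variables. -/
def thetaB (u : ι → Fin n) (j : ι) : ExteriorAlgebra ℂ (ι → ℂ) ⊗[ℂ] Env n := theta j ⊗ₜ B (u j)

/-- The commutator equals `θ_i θ_j ⊗ {B_{u i}, B_{u j}}`, and both tensor factors commute with those
of `thetaB u l`. -/
theorem commute_commutator_thetaB (u : ι → Fin n) (i j l : ι) :
    Commute (thetaB u i * thetaB u j - thetaB u j * thetaB u i) (thetaB u l) := by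
  have h : thetaB u i * thetaB u j - thetaB u j * thetaB u i =
      (theta i * theta j) ⊗ₜ[ℂ] (B (u i) * B (u j) + B (u j) * B (u i)) := by
    rw [thetaB, thetaB, Algebra.TensorProduct.tmul_mul_tmul, Algebra.TensorProduct.tmul_mul_tmul,
      theta_mul_theta j i, TensorProduct.neg_tmul, sub_neg_eq_add, TensorProduct.tmul_add]
  have h2 : theta i * theta j * theta l = theta l * (theta i * theta j) := by
    rw [mul_assoc, theta_mul_theta j l, mul_neg, ← mul_assoc, theta_mul_theta i l, neg_mul, neg_neg,
      mul_assoc]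
  rw [h, thetaB, Commute, SemiconjBy, Algebra.TensorProduct.tmul_mul_tmul,
    Algebra.TensorProduct.tmul_mul_tmul, h2, (commute_anticommutator_B _ _ _).eq]

/-- Reordering the `θ`s costs exactly the sign that the column operator attaches to the permutation.
-/
theorem smul_symProd_thetaB (u : ι → Fin n) {k : ℕ} (e : Fin k → ι) (he : Function.Injective e) :
    (k.factorial : ℂ) • symProd (thetaB u) (Finset.univ.image e) =
      ExteriorAlgebra.ιMulti ℂ k (fun r => (Pi.single (e r) 1 : ι → ℂ)) ⊗ₜ columnOp (u ∘ e) := by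
  rw [← sum_perm_prod_eq_symProd _ _ he, columnOp, TensorProduct.tmul_sum]
  refine Finset.sum_congr rfl fun σ _ => ?_
  have h := (ExteriorAlgebra.ιMulti ℂ k (M := ι → ℂ)).map_perm
    (fun r => (Pi.single (e r) 1 : ι → ℂ)) σ
  have h1 := prod_ofFn_tmul (fun r => theta (e (σ r))) (fun r => (B (u (e (σ r))) : Env n))
  have h2 : (List.ofFn fun r => theta (e (σ r))).prod =
      ExteriorAlgebra.ιMulti ℂ k ((fun r => (Pi.single (e r) 1 : ι → ℂ)) ∘ σ) := by
    rw [ExteriorAlgebra.ιMulti_apply]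
    rfl
  rw [TensorProduct.tmul_smul, TensorProduct.smul_tmul', Int.cast_smul_eq_zsmul,
    ← Units.smul_def, ← h, ← h2]
  exact h1

end Anticommuting

/-! ### Exchange relations between two columns -/

section TwoColumns

variable {ι : Type*}

/-- An enumeration of a finite set. -/
def enum (J : Finset ι) (r : Fin J.card) : ι := (J.equivFin.symm r : ι)

theorem enum_injective (J : Finset ι) : Function.Injective (enum J) :=
  Subtype.val_injective.comp J.equivFin.symm.injective

theorem image_enum [DecidableEq ι] (J : Finset ι) : Finset.univ.image (enum J) = J := by
  ext x
  simp only [Finset.mem_image, Finset.mem_univ, true_and, enum]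
  constructor
  · rintro ⟨r, rfl⟩
    exact (J.equivFin.symm r).2
  · intro hx
    exact ⟨J.equivFin ⟨x, hx⟩, by simp⟩

variable [DecidableEq ι] [Fintype ι]

/-- The product of the column operators of a set of letters and of its complement. -/
def twoCol (u : ι → Fin n) (J : Finset ι) : Env n :=
  columnOp (u ∘ enum Jᶜ) * columnOp (u ∘ enum J)

/-- The product of the anticommuting variables that goes with `twoCol`. -/
def twoTheta (J : Finset ι) : ExteriorAlgebra ℂ (ι → ℂ) :=
  ExteriorAlgebra.ιMulti ℂ _ (fun r => (Pi.single (enum Jᶜ r) 1 : ι → ℂ)) *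
    ExteriorAlgebra.ιMulti ℂ _ (fun r => (Pi.single (enum J r) 1 : ι → ℂ))

theorem smul_symProd_compl_mul (u : ι → Fin n) (J : Finset ι) :
    ((Jᶜ.card.factorial : ℂ) * J.card.factorial) •
      (symProd (thetaB u) Jᶜ * symProd (thetaB u) J) = twoTheta J ⊗ₜ[ℂ] twoCol u J := by
  have h1 := smul_symProd_thetaB u (enum Jᶜ) (enum_injective _)
  have h2 := smul_symProd_thetaB u (enum J) (enum_injective _)
  rw [image_enum] at h1 h2
  rw [mul_smul, ← mul_smul_comm, ← smul_mul_assoc, h1, h2, Algebra.TensorProduct.tmul_mul_tmul]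
  rfl

/-- `twoTheta J` is the product of all the variables, ordered by `Jᶜ` and then `J`; the determinant
in the correspondingly ordered basis takes the value 1 on it. -/
theorem exists_twoTheta_eq_one (J : Finset ι) :
    ∃ f : ExteriorAlgebra ℂ (ι → ℂ) →ₗ[ℂ] ℂ, f (twoTheta J) = 1 := by
  set g : Fin (Jᶜ.card + J.card) → ι := Fin.append (enum Jᶜ) (enum J) with hg
  have hinj : Function.Injective g := by
    rw [hg, Fin.append_injective_iff]
    refine ⟨enum_injective _, enum_injective _, ?_⟩
    intro a b h
    have ha : enum Jᶜ a ∈ Jᶜ := (Jᶜ.equivFin.symm a).2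
    have hb : enum J b ∈ J := (J.equivFin.symm b).2
    rw [h] at ha
    exact Finset.mem_compl.1 ha hb
  have hbij : Function.Bijective g := by
    rw [Fintype.bijective_iff_injective_and_card]
    refine ⟨hinj, ?_⟩
    rw [Fintype.card_fin, Finset.card_compl_add_card]
  set b := (Pi.basisFun ℂ ι).reindex (Equiv.ofBijective g hbij).symm with hb
  refine ⟨ExteriorAlgebra.liftAlternating (Pi.single _ b.det), ?_⟩
  have h : twoTheta J = ExteriorAlgebra.ιMulti ℂ _ b := by
    rw [twoTheta, ExteriorAlgebra.ιMulti_apply, ExteriorAlgebra.ιMulti_apply,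
      ExteriorAlgebra.ιMulti_apply, ← List.prod_append, ← List.ofFn_fin_append]
    congr 2
    funext r
    rw [hb, Module.Basis.reindex_apply, Equiv.symm_symm, Pi.basisFun_apply]
    refine Fin.addCases (fun a => ?_) (fun a => ?_) r <;> simp [hg]
  rw [h, ExteriorAlgebra.liftAlternating_apply_ιMulti, Pi.single_eq_same, Module.Basis.det_self]

/-- This is the Garnir relation that redistributes `J ∩ W` inside `W`, solved for the term of `J`.
The functional `f` removes the `θ`s; the scalars it gives on other sets are irrelevant. -/
theorem twoCol_mem_span (u : ι → Fin n) (J W : Finset ι) (hW : J.card < W.card) :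
    twoCol u J ∈ Submodule.span ℂ (twoCol u '' {J' | J.card < J'.card ∨
      (J'.card = J.card ∧ J' \ W = J \ W ∧ J' ≠ J)}) := by
  set S := Submodule.span ℂ (twoCol u '' {J' | J.card < J'.card ∨
      (J'.card = J.card ∧ J' \ W = J \ W ∧ J' ≠ J)}) with hS
  obtain ⟨f, hf⟩ := exists_twoTheta_eq_one J
  let ψ : ExteriorAlgebra ℂ (ι → ℂ) ⊗[ℂ] Env n →ₗ[ℂ] Env n :=
    (TensorProduct.lid ℂ (Env n)).toLinearMap ∘ₗ TensorProduct.map f LinearMap.id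
  let c : Finset ι → Env n := fun J' => ψ (symProd (thetaB u) J'ᶜ * symProd (thetaB u) J')
  have hfac : ∀ J' : Finset ι, ((J'ᶜ.card.factorial : ℂ) * J'.card.factorial) ≠ 0 := fun J' =>
    mul_ne_zero (Nat.cast_ne_zero.2 (Nat.factorial_ne_zero _))
      (Nat.cast_ne_zero.2 (Nat.factorial_ne_zero _))
  have hc : ∀ J' : Finset ι, ((J'ᶜ.card.factorial : ℂ) * J'.card.factorial) • c J' =
      f (twoTheta J') • twoCol u J' := by
    intro J'
    change _ • ψ _ = _
    rw [← map_smul, smul_symProd_compl_mul]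
    simp [ψ]
  have hcS : ∀ J', (J.card < J'.card ∨ (J'.card = J.card ∧ J' \ W = J \ W ∧ J' ≠ J)) →
      c J' ∈ S := by
    intro J' hJ'
    rw [← Submodule.smul_mem_iff S (hfac J'), hc]
    exact Submodule.smul_mem _ _ (Submodule.subset_span ⟨J', hJ', rfl⟩)
  -- In the exchange identity for `J'`, every term except the erased sets has a right factor with
  -- more than `|J|` letters.
  have hrel : ∀ J' : Finset ι, J'.card = J.card + 1 → ∑ j ∈ J', c (J'.erase j) ∈ S := by
    intro J' hJ'
    have h := congrArg ψ (sum_symProd_compl_mul (commute_commutator_thetaB u) J')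
    rw [map_smul, map_sub, map_sum, map_sum] at h
    have h2 : ∑ j ∈ J', c (J'.erase j) = ∑ i ∈ J'ᶜ, c (insert i J') -
        ((J'ᶜ.card : ℂ) - J'.card) • c J' := by
      change _ = _ - (_ : ℂ) • ψ _
      rw [h]
      change _ = (∑ i ∈ J'ᶜ, c (insert i J')) - ((∑ i ∈ J'ᶜ, c (insert i J')) -
        ∑ j ∈ J', c (J'.erase j))
      abel
    rw [h2]
    refine sub_mem (sum_mem fun i hi => hcS _ (Or.inl ?_))
      (Submodule.smul_mem _ _ (hcS _ (Or.inl (by omega))))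
    rw [Finset.card_insert_of_notMem (Finset.mem_compl.1 hi)]
    omega
  have hR : (J \ W).card + (J ∩ W).card = J.card := by
    rw [add_comm]; exact Finset.card_inter_add_card_sdiff J W
  have hG := sum_powersetCard_union_mem S c J.card hrel W hW (J \ W)
    (Finset.disjoint_sdiff) (by omega)
  have hq : J.card - (J \ W).card = (J ∩ W).card := by omega
  have hmem : J ∩ W ∈ W.powersetCard (J.card - (J \ W).card) :=
    Finset.mem_powersetCard.2 ⟨Finset.inter_subset_right, hq.symm⟩
  have hJ0 : J ∩ W ∪ J \ W = J := by
    rw [Finset.union_comm]; exact Finset.sdiff_union_inter J W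
  rw [← Finset.add_sum_erase _ _ hmem, hJ0] at hG
  have hrest : ∑ Q ∈ (W.powersetCard (J.card - (J \ W).card)).erase (J ∩ W), c (Q ∪ J \ W) ∈ S := by
    refine sum_mem fun Q hQ => hcS _ (Or.inr ?_)
    rw [Finset.mem_erase, Finset.mem_powersetCard] at hQ
    obtain ⟨hne, hQW, hQc⟩ := hQ
    have hd : Disjoint Q (J \ W) := Finset.disjoint_sdiff.mono_left hQW
    refine ⟨?_, ?_, ?_⟩
    · rw [Finset.card_union_of_disjoint hd, hQc]; omega
    · rw [Finset.union_sdiff_distrib, Finset.sdiff_eq_empty_iff_subset.2 hQW, Finset.empty_union]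
      simp
    · intro h
      apply hne
      rw [← h, Finset.union_inter_distrib_right, Finset.inter_eq_left.2 hQW]
      simp
  have hJS := (Submodule.add_mem_iff_left S hrest).1 hG
  rw [← Submodule.smul_mem_iff S (hfac J), hc, hf, one_smul] at hJS
  exact hJS

end TwoColumns

/-! ### Straightening of lists of columns -/

/-- The column `I` may stand to the right of the column `J` in a semistandard tableau. -/
def Dominates (J I : Finset (Fin n)) : Prop :=
  ∀ x : Fin n, (I.filter (· ≤ x)).card ≤ (J.filter (· ≤ x)).card

instance : IsTrans (Finset (Fin n)) Dominates := ⟨fun _ _ _ h1 h2 x => (h2 x).trans (h1 x)⟩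

/-- The weight of a letter: letters have positive weights, which decrease along the alphabet so
slowly that longer columns are heavier. -/
def letterWeight (e : Fin n) : ℕ := n * n + n - e

/-- The weight of a column. -/
def colWeight (I : Finset (Fin n)) : ℕ := ∑ e ∈ I, letterWeight e

theorem letterWeight_lt {a b : Fin n} (h : a < b) : letterWeight b < letterWeight a := by
  have := Fin.lt_def.1 h
  have := b.2
  unfold letterWeight
  omega

theorem injective_comp_enum_iff {ι : Type*} [DecidableEq ι] (u : ι → Fin n) (K : Finset ι) :
    Function.Injective (u ∘ enum K) ↔ Set.InjOn u K := by
  constructor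
  · intro h a ha b hb hab
    rw [← image_enum K] at ha hb
    simp only [Finset.coe_image, Finset.coe_univ, Set.image_univ, Set.mem_range] at ha hb
    obtain ⟨a, rfl⟩ := ha
    obtain ⟨b, rfl⟩ := hb
    rw [h hab]
  · intro h a b hab
    exact enum_injective K (h (K.equivFin.symm a).2 (K.equivFin.symm b).2 hab)

theorem twoCol_eq_zero {ι : Type*} [DecidableEq ι] [Fintype ι] {u : ι → Fin n} {J : Finset ι}
    (h : ¬ (Set.InjOn u (Jᶜ : Finset ι) ∧ Set.InjOn u J)) : twoCol u J = 0 := by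
  rw [← injective_comp_enum_iff, ← injective_comp_enum_iff, not_and_or] at h
  rcases h with h | h
  · rw [twoCol, columnOp_of_not_injective h, zero_mul]
  · rw [twoCol, columnOp_of_not_injective h, mul_zero]

theorem exists_twoCol_eq_smul {ι : Type*} [DecidableEq ι] [Fintype ι] {u : ι → Fin n}
    {J : Finset ι} (h1 : Set.InjOn u (Jᶜ : Finset ι)) (h2 : Set.InjOn u J) :
    ∃ c : ℂ, c ≠ 0 ∧ twoCol u J = c • (colF (Jᶜ.image u) * colF (J.image u)) := by
  obtain ⟨c1, hc1, e1⟩ := exists_columnOp_eq_smul ((injective_comp_enum_iff _ _).2 h1)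
  obtain ⟨c2, hc2, e2⟩ := exists_columnOp_eq_smul ((injective_comp_enum_iff _ _).2 h2)
  rw [← Finset.image_image, image_enum] at e1 e2
  exact ⟨c1 * c2, mul_ne_zero hc1 hc2, by rw [twoCol, e1, e2, smul_mul_smul_comm]⟩

/-- Letter weights lie between `n² + 1` and `n² + n`; since `|I| ≤ n`, the spread over `|I|` letters
is smaller than the weight of one more letter. -/
theorem colWeight_lt_of_card_lt {I J : Finset (Fin n)} (h : I.card < J.card) :
    colWeight I < colWeight J := by
  have hI : colWeight I ≤ I.card • (n * n + n) :=
    Finset.sum_le_card_nsmul _ _ _ fun e _ => Nat.sub_le _ _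
  have hJ : J.card • (n * n + 1) ≤ colWeight J :=
    Finset.card_nsmul_le_sum _ _ _ fun e _ => by
      have := e.2
      unfold letterWeight
      omega
  have hn : I.card ≤ n := by simpa using I.card_le_univ
  simp only [smul_eq_mul] at hI hJ
  nlinarith

/-- Equally many letters enter and leave, and each entering letter is heavier than each leaving one.
-/
theorem sum_letterWeight_lt {ι : Type*} [DecidableEq ι] (u : ι → Fin n) {J J' : Finset ι}
    (x : Fin n) (hc : J'.card = J.card) (hne : J' ≠ J) (h1 : ∀ j ∈ J' \ J, u j ≤ x)
    (h2 : ∀ j ∈ J \ J', x < u j) :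
    ∑ j ∈ J, letterWeight (u j) < ∑ j ∈ J', letterWeight (u j) := by
  rw [← Finset.sum_inter_add_sum_sdiff J J', ← Finset.sum_inter_add_sum_sdiff J' J,
    Finset.inter_comm J' J]
  have hcard : (J' \ J).card = (J \ J').card := Finset.card_sdiff_comm hc
  have hpos : (J \ J').Nonempty := by
    rw [Finset.sdiff_nonempty]
    exact fun h => hne (Finset.eq_of_subset_of_card_le h hc.le).symm
  have hlt : ∑ j ∈ J \ J', letterWeight (u j) < ∑ j ∈ J \ J', letterWeight x :=
    Finset.sum_lt_sum_of_nonempty hpos fun j hj => letterWeight_lt (h2 j hj)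
  have hle : (J' \ J).card • letterWeight x ≤ ∑ j ∈ J' \ J, letterWeight (u j) :=
    Finset.card_nsmul_le_sum _ _ _ fun j hj =>
      (h1 j hj).eq_or_lt.elim (fun h => by rw [h]) fun h => (letterWeight_lt h).le
  rw [Finset.sum_const, ← hcard] at hlt
  omega

/-- Straightening of two columns. -/
theorem colF_mul_colF_mem_span {I J : Finset (Fin n)} (h : ¬ Dominates J I) :
    colF I * colF J ∈ Submodule.span ℂ {y | ∃ I' J' : Finset (Fin n),
      colWeight I' + colWeight J' = colWeight I + colWeight J ∧ colWeight J < colWeight J' ∧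
      y = colF I' * colF J'} := by
  set S := Submodule.span ℂ {y | ∃ I' J' : Finset (Fin n),
      colWeight I' + colWeight J' = colWeight I + colWeight J ∧ colWeight J < colWeight J' ∧
      y = colF I' * colF J'} with hS
  simp only [Dominates, not_forall, not_le] at h
  obtain ⟨x, hx⟩ := h
  -- The positions form a disjoint union, so a letter common to both columns is counted twice.
  let u : I ⊕ J → Fin n := Sum.elim Subtype.val Subtype.val
  let J₀ : Finset (I ⊕ J) := Finset.univ.map Function.Embedding.inr
  -- By the choice of `x`, this set has more than `|J|` elements. Exchanges inside it bring letters
  -- `≤ x` into the left column and remove letters `> x`, so that column gains weight.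
  let W : Finset (I ⊕ J) := (Finset.univ.filter fun i : I => (i : Fin n) ≤ x).disjSum
    (Finset.univ.filter fun j : J => ¬ (j : Fin n) ≤ x)
  have hJ₀inl : ∀ i : I, Sum.inl i ∉ J₀ := by simp [J₀]
  have hJ₀inr : ∀ j : J, Sum.inr j ∈ J₀ := by simp [J₀]
  have hcJ₀ : J₀.card = J.card := by simp [J₀]
  have hsub : ∀ (K : Finset (Fin n)) (p : Fin n → Prop) [DecidablePred p],
      (Finset.univ.filter fun i : K => p i).card = (K.filter p).card := by
    intro K p _
    rw [← Finset.card_map (Function.Embedding.subtype _)]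
    congr 1
    ext a
    simp [and_comm]
  have hcW : J₀.card < W.card := by
    rw [Finset.card_disjSum, hsub I (· ≤ x), hsub J (fun j => ¬ j ≤ x), hcJ₀,
      ← Finset.card_filter_add_card_filter_not (s := J) (· ≤ x)]
    omega
  have himJ : J₀.image u = J := by
    ext a
    simp [J₀, u]
  have himI : J₀ᶜ.image u = I := by
    ext a
    simp [J₀, u]
  have hinjI : Set.InjOn u (J₀ᶜ : Finset (I ⊕ J)) := by
    rintro (a | a) ha (b | b) hb hab
    · exact congrArg _ (Subtype.ext hab)
    · exact absurd (hJ₀inr b) (Finset.mem_compl.1 hb)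
    · exact absurd (hJ₀inr a) (Finset.mem_compl.1 ha)
    · exact absurd (hJ₀inr a) (Finset.mem_compl.1 ha)
  have hinjJ : Set.InjOn u J₀ := by
    rintro (a | a) ha (b | b) hb hab
    · exact absurd ha (hJ₀inl a)
    · exact absurd ha (hJ₀inl a)
    · exact absurd hb (hJ₀inl b)
    · exact congrArg _ (Subtype.ext hab)
  have hw : ∀ K : Finset (I ⊕ J), Set.InjOn u K →
      colWeight (K.image u) = ∑ k ∈ K, letterWeight (u k) := fun K hK => Finset.sum_image hK
  have hwI : colWeight I = ∑ k ∈ J₀ᶜ, letterWeight (u k) := by rw [← hw _ hinjI, himI]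
  have hwJ : colWeight J = ∑ k ∈ J₀, letterWeight (u k) := by rw [← hw _ hinjJ, himJ]
  have hmem := twoCol_mem_span u J₀ W hcW
  have hle : Submodule.span ℂ (twoCol u '' {J' | J₀.card < J'.card ∨
      (J'.card = J₀.card ∧ J' \ W = J₀ \ W ∧ J' ≠ J₀)}) ≤ S := by
    rw [Submodule.span_le]
    rintro _ ⟨J', hJ', rfl⟩
    by_cases hi : Set.InjOn u (J'ᶜ : Finset (I ⊕ J)) ∧ Set.InjOn u J'
    · obtain ⟨hi1, hi2⟩ := hi
      obtain ⟨c, _, hc⟩ := exists_twoCol_eq_smul hi1 hi2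
      rw [hc]
      refine Submodule.smul_mem _ _ (Submodule.subset_span ⟨_, _, ?_, ?_, rfl⟩)
      · rw [hw _ hi1, hw _ hi2, hwI, hwJ, Finset.sum_compl_add_sum, Finset.sum_compl_add_sum]
      · rcases hJ' with hlt | ⟨hcard, hsd, hne⟩
        · refine colWeight_lt_of_card_lt ?_
          rw [Finset.card_image_of_injOn hi2, ← hcJ₀]
          exact hlt
        · rw [hw _ hi2, hwJ]
          have hW1 : ∀ j ∈ J' \ J₀, j ∈ W := by
            intro j hj
            by_contra hjW
            rw [Finset.mem_sdiff] at hj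
            have : j ∈ J₀ \ W := hsd ▸ Finset.mem_sdiff.2 ⟨hj.1, hjW⟩
            exact hj.2 (Finset.mem_sdiff.1 this).1
          have hW2 : ∀ j ∈ J₀ \ J', j ∈ W := by
            intro j hj
            by_contra hjW
            rw [Finset.mem_sdiff] at hj
            have : j ∈ J' \ W := hsd ▸ Finset.mem_sdiff.2 ⟨hj.1, hjW⟩
            exact hj.2 (Finset.mem_sdiff.1 this).1
          refine sum_letterWeight_lt u x hcard hne ?_ ?_
          · rintro (j | j) hj
            · have := hW1 _ hj
              simpa [W, u] using this
            · exact absurd (hJ₀inr j) (Finset.mem_sdiff.1 hj).2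
          · rintro (j | j) hj
            · exact absurd (Finset.mem_sdiff.1 hj).1 (hJ₀inl j)
            · have := hW2 _ hj
              simpa [W, u] using this
    · rw [twoCol_eq_zero hi]
      exact zero_mem S
  obtain ⟨c, hc0, hc⟩ := exists_twoCol_eq_smul hinjI hinjJ
  rw [hc, himI, himJ] at hmem
  exact (Submodule.smul_mem_iff S hc0).1 (hle hmem)

/-- The product of the column operators of a list of columns, numbered from left to right. -/
def listOp (L : List (Finset (Fin n))) : Env n := (L.map colF).reverse.prod

theorem listOp_append (L L' : List (Finset (Fin n))) :
    listOp (L ++ L') = listOp L' * listOp L := by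
  simp [listOp]

theorem listOp_cons (a : Finset (Fin n)) (L : List (Finset (Fin n))) :
    listOp (a :: L) = listOp L * colF a := by
  simp [listOp]

/-- The weight of a list of columns. -/
def listWeight (L : List (Finset (Fin n))) : ℕ := (L.map colWeight).sum

/-- The sum of the weights of the columns, each multiplied with its position. -/
def moment : List (Finset (Fin n)) → ℕ
  | [] => 0
  | _ :: L => moment L + listWeight L

/-- Weight passes to the position one step further left, so the position-weighted sum drops; this
makes straightening terminate. -/
theorem moment_lt (L₁ L₂ : List (Finset (Fin n))) {I J I' J' : Finset (Fin n)}
    (h : colWeight I' + colWeight J' = colWeight I + colWeight J)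
    (hlt : colWeight J < colWeight J') :
    moment (L₁ ++ J' :: I' :: L₂) < moment (L₁ ++ J :: I :: L₂) ∧
      listWeight (L₁ ++ J' :: I' :: L₂) = listWeight (L₁ ++ J :: I :: L₂) := by
  induction L₁ with
  | nil =>
    simp only [List.nil_append, moment, listWeight, List.map_cons, List.sum_cons]
    omega
  | cons a L ih =>
    simp only [List.cons_append, moment]
    refine ⟨by omega, ?_⟩
    have := ih.2
    simp only [listWeight, List.map_cons, List.sum_cons] at this ⊢
    rw [this]

theorem exists_split_of_not_isChain {α : Type*} {R : α → α → Prop} {L : List α}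
    (h : ¬ L.IsChain R) : ∃ L₁ a b L₂, L = L₁ ++ a :: b :: L₂ ∧ ¬ R a b := by
  induction L with
  | nil => exact absurd List.IsChain.nil h
  | cons a L ih =>
    cases L with
    | nil => exact absurd (List.IsChain.singleton a) h
    | cons b L =>
      rw [List.isChain_cons_cons, not_and_or] at h
      rcases h with h | h
      · exact ⟨[], a, b, L, rfl, h⟩
      · obtain ⟨L₁, c, d, L₂, e, hR⟩ := ih h
        exact ⟨a :: L₁, c, d, L₂, by rw [e]; rfl, hR⟩

theorem listOp_mem_span (L : List (Finset (Fin n))) :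
    listOp L ∈ Submodule.span ℂ (listOp '' {L : List (Finset (Fin n)) | L.IsChain Dominates}) := by
  induction hm : moment L using Nat.strong_induction_on generalizing L with
  | _ m ih =>
    by_cases hL : L.IsChain Dominates
    · exact Submodule.subset_span ⟨L, hL, rfl⟩
    · obtain ⟨L₁, J, I, L₂, rfl, hJI⟩ := exists_split_of_not_isChain hL
      have h := Submodule.mem_map_of_mem
        (f := LinearMap.mulLeft ℂ (listOp L₂) ∘ₗ LinearMap.mulRight ℂ (listOp L₁))
        (colF_mul_colF_mem_span hJI)
      have e : ∀ I J : Finset (Fin n), listOp (L₁ ++ J :: I :: L₂) =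
          (LinearMap.mulLeft ℂ (listOp L₂) ∘ₗ LinearMap.mulRight ℂ (listOp L₁))
            (colF I * colF J) := by
        intro I J
        rw [listOp_append, listOp_cons, listOp_cons]
        simp [mul_assoc]
      rw [← e, Submodule.map_span] at h
      refine Submodule.span_le.2 ?_ h
      rintro _ ⟨_, ⟨I', J', hw, hlt, rfl⟩, rfl⟩
      rw [← e]
      exact ih _ (hm ▸ (moment_lt L₁ L₂ hw hlt).1) _ rfl

theorem span_listOp_isChain :
    Submodule.span ℂ (listOp '' {L : List (Finset (Fin n)) | L.IsChain Dominates}) = ⊤ := by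
  rw [eq_top_iff, ← Algebra.top_toSubmodule, ← adjoin_range_B, Algebra.adjoin_eq_span,
    Submodule.span_le]
  intro x hx
  have : ∃ L : List (Finset (Fin n)), listOp L = x := by
    induction hx using Submonoid.closure_induction with
    | mem x hx =>
      obtain ⟨i, rfl⟩ := hx
      exact ⟨[{i}], by rw [listOp_cons, colF_singleton]; simp [listOp]⟩
    | one => exact ⟨[], rfl⟩
    | mul x y _ _ hx hy =>
      obtain ⟨L, rfl⟩ := hx
      obtain ⟨L', rfl⟩ := hy
      exact ⟨L' ++ L, listOp_append _ _⟩
  obtain ⟨L, rfl⟩ := this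
  exact listOp_mem_span L

/-! ### From chains of columns to tableaux -/

/-- The `i`-th smallest element of a set of letters. -/
def nth (I : Finset (Fin n)) (i : ℕ) : ℕ :=
  if h : i < I.card then (I.orderEmbOfFin rfl ⟨i, h⟩ : ℕ) else 0

theorem nth_of_lt {I : Finset (Fin n)} {i : ℕ} (h : i < I.card) :
    nth I i = (I.orderEmbOfFin rfl ⟨i, h⟩ : ℕ) := dif_pos h

theorem nth_strict {I : Finset (Fin n)} {i j : ℕ} (hij : i < j) (hj : j < I.card) :
    nth I i < nth I j := by
  rw [nth_of_lt hj, nth_of_lt (hij.trans hj)]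
  exact (I.orderEmbOfFin rfl).strictMono (Fin.mk_lt_mk.2 hij)

theorem Dominates.card_le {J I : Finset (Fin n)} (h : Dominates J I) : I.card ≤ J.card := by
  rcases n with _ | n
  · simp [Finset.eq_empty_of_isEmpty I]
  · have := h (Fin.last n)
    simpa [Fin.le_last] using this

/-- If `x` is the entry of `I` at index `i`, then `I` has at least `i + 1` letters `≤ x`; were the
entry of `J` larger, `J` would have at most `i`. -/
theorem Dominates.nth_le {J I : Finset (Fin n)} (h : Dominates J I) {i : ℕ} (hi : i < I.card) :
    nth J i ≤ nth I i := by
  have hJ := hi.trans_le h.card_le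
  rw [nth_of_lt hi, nth_of_lt hJ]
  by_contra! hlt
  set x := I.orderEmbOfFin rfl ⟨i, hi⟩ with hx
  have h1 : i + 1 ≤ (I.filter (· ≤ x)).card := by
    have : ((Finset.Iic (⟨i, hi⟩ : Fin I.card)).map (I.orderEmbOfFin rfl).toEmbedding).card ≤
        (I.filter (· ≤ x)).card := by
      refine Finset.card_le_card fun y hy => ?_
      obtain ⟨r, hr, rfl⟩ := Finset.mem_map.1 hy
      exact Finset.mem_filter.2 ⟨I.orderEmbOfFin_mem rfl r,
        (I.orderEmbOfFin rfl).monotone (Finset.mem_Iic.1 hr)⟩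
    simpa using this
  have h2 : (J.filter (· ≤ x)).card ≤ i := by
    have : (J.filter (· ≤ x)).card ≤
        ((Finset.Iio (⟨i, hJ⟩ : Fin J.card)).map (J.orderEmbOfFin rfl).toEmbedding).card := by
      refine Finset.card_le_card fun y hy => ?_
      obtain ⟨hyJ, hyx⟩ := Finset.mem_filter.1 hy
      have : y ∈ Set.range (J.orderEmbOfFin rfl) := by
        rw [Finset.range_orderEmbOfFin]; exact hyJ
      obtain ⟨r, rfl⟩ := this
      refine Finset.mem_map.2 ⟨r, Finset.mem_Iio.2 ?_, rfl⟩
      exact (J.orderEmbOfFin rfl).lt_iff_lt.1 (hyx.trans_lt (Fin.lt_def.2 hlt))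
    simpa using this
  have := h x
  omega

section Assembly

variable (m : ℕ) (C : ℕ → Finset (Fin n))

/-- The Young diagram whose columns have the lengths of the given sets. -/
def columnsShape : YoungDiagram where
  -- Quantifying over all columns `≤ c.2` makes this a lower set for arbitrary `C`; under dominance
  -- the condition on the last column suffices.
  cells := ((Finset.range n) ×ˢ (Finset.range m)).filter fun c => ∀ j ≤ c.2, c.1 < (C j).card
  isLowerSet := by
    rintro ⟨a, b⟩ ⟨a', b'⟩ ⟨ha, hb⟩ h
    simp only [Finset.mem_coe, Finset.mem_filter, Finset.mem_product, Finset.mem_range] at h ⊢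
    simp only at ha hb
    exact ⟨⟨ha.trans_lt h.1.1, hb.trans_lt h.1.2⟩,
      fun j hj => ha.trans_lt (h.2 j (hj.trans hb))⟩

variable (hC : ∀ i j, i < j → j < m → Dominates (C i) (C j))

include hC in
theorem mem_columnsShape {i j : ℕ} : (i, j) ∈ columnsShape m C ↔ j < m ∧ i < (C j).card := by
  change (i, j) ∈ Finset.filter _ _ ↔ _
  simp only [Finset.mem_filter, Finset.mem_product, Finset.mem_range]
  constructor
  · exact fun h => ⟨h.1.2, h.2 _ le_rfl⟩
  · rintro ⟨hj, hi⟩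
    refine ⟨⟨hi.trans_le (by simpa using (C j).card_le_univ), hj⟩, fun j' hj' => ?_⟩
    rcases hj'.eq_or_lt with rfl | hlt
    · exact hi
    · exact hi.trans_le (hC _ _ hlt hj).card_le

/-- The tableau with a given sequence of columns. -/
def ofColumns : Tableau n where
  shape := columnsShape m C
  filling :=
    { entry := fun i j => if j < m ∧ i < (C j).card then nth (C j) i else 0
      row_weak' := by
        intro i j1 j2 hj h
        rw [mem_columnsShape m C hC] at h
        have hd := hC _ _ hj h.1
        rw [if_pos ⟨hj.trans h.1, h.2.trans_le hd.card_le⟩, if_pos h]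
        exact hd.nth_le h.2
      col_strict' := by
        intro i1 i2 j hi h
        rw [mem_columnsShape m C hC] at h
        rw [if_pos ⟨h.1, hi.trans h.2⟩, if_pos h]
        exact nth_strict hi h.2
      zeros' := by
        intro i j h
        rw [mem_columnsShape m C hC] at h
        exact if_neg h }
  entry_lt := by
    intro i j h
    rw [mem_columnsShape m C hC] at h
    change (if j < m ∧ i < (C j).card then nth (C j) i else 0) < n
    rw [if_pos h, nth_of_lt h.2]
    exact Fin.is_lt _

theorem mem_ofColumns_shape {i j : ℕ} :
    (i, j) ∈ (ofColumns m C hC).shape ↔ j < m ∧ i < (C j).card :=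
  mem_columnsShape m C hC

theorem ofColumns_filling {i j : ℕ} (hj : j < m) (hi : i < (C j).card) :
    (ofColumns m C hC).filling i j = nth (C j) i := by
  exact if_pos ⟨hj, hi⟩

theorem ofColumns_colLen {j : ℕ} (hj : j < m) :
    (ofColumns m C hC).shape.colLen j = (C j).card := by
  refine eq_of_forall_lt_iff fun i => ?_
  rw [← YoungDiagram.mem_iff_lt_colLen, mem_ofColumns_shape]
  simp [hj]

theorem columnOp_ofColumns {j : ℕ} (hj : j < m) :
    columnOp ((ofColumns m C hC).column j) = colF (C j) := by
  have hl := ofColumns_colLen m C hC hj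
  rw [← columnOp_orderEmbOfFin (C j) hl.symm]
  congr 1
  funext r
  have hr : (r : ℕ) < (C j).card := hl ▸ r.2
  apply Fin.ext
  change (ofColumns m C hC).filling r j = _
  rw [ofColumns_filling m C hC hj hr, nth_of_lt hr]
  rfl

theorem ofColumns_op (hne : ∀ j < m, (C j).Nonempty) :
    (ofColumns m C hC).op = listOp ((List.range m).map C) := by
  have hm : (ofColumns m C hC).numCols = m := by
    refine eq_of_forall_lt_iff fun j => ?_
    rw [Tableau.numCols, ← YoungDiagram.mem_iff_lt_rowLen, mem_ofColumns_shape]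
    exact ⟨fun h => h.1, fun h => ⟨h, Finset.card_pos.2 (hne j h)⟩⟩
  rw [Tableau.op, hm, listOp, List.map_map, ← List.map_reverse]
  congr 1
  refine List.map_congr_left fun j hj => ?_
  rw [List.mem_reverse, List.mem_range] at hj
  exact columnOp_ofColumns m C hC hj

end Assembly

/-- Empty columns have operator 1 and are discarded, because `numCols` only counts nonempty ones. -/
theorem exists_op_eq_listOp {L : List (Finset (Fin n))} (hL : L.IsChain Dominates) :
    ∃ A : Tableau n, A.op = listOp L := by
  classical
  have hL' : (L.filter (· ≠ ∅)).Pairwise Dominates :=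
    (List.isChain_iff_pairwise.1 hL).filter _
  have hop : listOp L = listOp (L.filter (· ≠ ∅)) := by
    clear hL hL'
    induction L with
    | nil => rfl
    | cons a L ih =>
      rw [listOp_cons, ih]
      by_cases ha : a = ∅
      · simp [ha, colF_empty]
      · simp [ha, listOp_cons]
  have hne : ∀ a ∈ L.filter (· ≠ ∅), a.Nonempty := by
    intro a ha
    exact Finset.nonempty_iff_ne_empty.2 (by simpa using (List.mem_filter.1 ha).2)
  rw [hop]
  generalize L.filter (· ≠ ∅) = K at hL' hne
  have hget : ∀ j (hj : j < K.length), K.getD j ∅ = K[j] := fun j hj => by simp [hj]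
  refine ⟨ofColumns K.length (fun j => K.getD j ∅) ?_, ?_⟩
  · intro i j hij hj
    rw [hget i (hij.trans hj), hget j hj]
    exact List.pairwise_iff_getElem.1 hL' i j _ _ hij
  · rw [ofColumns_op]
    · congr 1
      refine List.ext_getElem (by simp) fun j h1 h2 => ?_
      rw [List.getElem_map, List.getElem_range, hget j h2]
    · intro j hj
      rw [hget j hj]
      exact hne _ (List.getElem_mem hj)

theorem span_range_op (n : ℕ) : Submodule.span ℂ (Set.range (Tableau.op (n := n))) = ⊤ := by
  rw [eq_top_iff, ← span_listOp_isChain, Submodule.span_le]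
  rintro _ ⟨L, hL, rfl⟩
  obtain ⟨A, hA⟩ := exists_op_eq_listOp hL
  exact Submodule.subset_span ⟨A, hA⟩

/-! ### Green's ansatz -/

/-- Cross terms cancel in anticommutators of the sums, and a quadratic expression in one row
commutes with every other row. Only the identity for a single boson family remains. -/
theorem tripleRel_sum {α A : Type*} [Fintype α] [DecidableEq α] [Ring A] [Algebra ℂ A]
    (y : α → Gen n → A)
    (hcomm : ∀ a i j ξ η, y a (i, ξ) * y a (j, η) - y a (j, η) * y a (i, ξ) =
      (if i = j then (((η : ℤ) - (ξ : ℤ) : ℤ) : ℂ) / 2 else 0) • 1)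
    (hanti : ∀ a b, a ≠ b → ∀ g h, y a g * y b h = -(y b h * y a g)) :
    TripleRel fun g => ∑ a, y a g := by
  intro i j l ξ η ε
  have h1 : (∑ a, y a (i, ξ)) * (∑ a, y a (j, η)) + (∑ a, y a (j, η)) * (∑ a, y a (i, ξ)) =
      ∑ a, (y a (i, ξ) * y a (j, η) + y a (j, η) * y a (i, ξ)) := by
    rw [Finset.sum_mul_sum, Finset.sum_mul_sum, Finset.sum_comm (f := fun a b => y a (j, η) * _),
      ← Finset.sum_add_distrib]
    refine Finset.sum_congr rfl fun a _ => ?_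
    rw [← Finset.sum_add_distrib, Finset.sum_eq_single a]
    · intro b _ hb
      rw [hanti b a hb]
      simp
    · simp
  have h2 : ∀ a b, (y a (i, ξ) * y a (j, η) + y a (j, η) * y a (i, ξ)) * y b (l, ε) -
      y b (l, ε) * (y a (i, ξ) * y a (j, η) + y a (j, η) * y a (i, ξ)) = if a = b then
      (if i = l then (((ε : ℤ) - (ξ : ℤ) : ℤ) : ℂ) else 0) • y a (j, η) +
      (if j = l then (((ε : ℤ) - (η : ℤ) : ℤ) : ℂ) else 0) • y a (i, ξ) else 0 := by
    intro a b
    rcases eq_or_ne a b with rfl | hab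
    · have e : ∀ x z w : A, (x * z + z * x) * w - w * (x * z + z * x) =
          x * (z * w - w * z) + (x * w - w * x) * z + (z * (x * w - w * x) +
            (z * w - w * z) * x) := by intro x z w; noncomm_ring
      rw [e, hcomm, hcomm, if_pos rfl]
      simp only [mul_smul_comm, smul_mul_assoc, mul_one, one_mul]
      have e2 : ∀ (c d : ℂ) (x z : A), d • x + c • z + (c • z + d • x) =
          (c * 2) • z + (d * 2) • x := by
        intro c d x z
        rw [mul_two, mul_two, add_smul, add_smul]
        abel
      rw [e2]
      split_ifs <;> simp
    · rw [if_neg hab]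
      have e : ∀ x z w : A, x * w = -(w * x) → z * w = -(w * z) → x * z * w = w * (x * z) := by
        intro x z w hx hz
        rw [mul_assoc, hz, mul_neg, ← mul_assoc, hx, neg_mul, neg_neg, mul_assoc]
      rw [add_mul, mul_add, e _ _ _ (hanti a b hab _ _) (hanti a b hab _ _),
        e _ _ _ (hanti a b hab _ _) (hanti a b hab _ _), sub_self]
  simp only
  rw [h1, Finset.sum_mul_sum, Finset.sum_mul_sum, Finset.sum_comm (f := fun b a => y b (l, ε) * _),
    ← Finset.sum_sub_distrib, Finset.smul_sum, Finset.smul_sum, ← Finset.sum_add_distrib]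
  refine Finset.sum_congr rfl fun a _ => ?_
  rw [← Finset.sum_sub_distrib, Finset.sum_congr rfl fun b _ => h2 a b]
  simp

/-- Exponents are indexed by a row and a letter. -/
abbrev Cell (n : ℕ) : Type := Fin n ×ₗ Fin n

/-- The polynomials on which the generators act. -/
abbrev Fock (n : ℕ) : Type := MvPolynomial (Cell n) ℂ

/-- The sign with which the Klein operator of the row `a` acts on a variable. -/
def kleinSign (a : Fin n) (v : Cell n) : ℂ := if (ofLex v).1 < a then -1 else 1

theorem kleinSign_mul_self (a : Fin n) (v : Cell n) : kleinSign a v * kleinSign a v = 1 := by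
  unfold kleinSign
  split_ifs <;> norm_num

/-- The Klein operator of the row `a`, which changes the signs of the variables of the previous
rows. -/
def klein (a : Fin n) : Fock n →ₐ[ℂ] Fock n :=
  MvPolynomial.aeval fun v => kleinSign a v • MvPolynomial.X v

theorem klein_X (a : Fin n) (v : Cell n) :
    klein a (MvPolynomial.X v) = kleinSign a v • MvPolynomial.X v := by
  simp [klein]

theorem klein_klein (a b : Fin n) (p : Fock n) : klein a (klein b p) = klein b (klein a p) := by
  have : (klein a).comp (klein b) = (klein b).comp (klein a) := by
    ext v : 1
    simp [klein_X, smul_smul, mul_comm]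
  exact DFunLike.congr_fun this p

theorem klein_self (a : Fin n) (p : Fock n) : klein a (klein a p) = p := by
  have : (klein a).comp (klein a) = AlgHom.id ℂ _ := by
    ext v : 1
    simp [klein_X, smul_smul, kleinSign_mul_self]
  exact DFunLike.congr_fun this p

/-- Multiplication with a variable or differentiation with respect to it. -/
def boson (v : Cell n) (ε : ℤˣ) : Module.End ℂ (Fock n) :=
  if ε = 1 then LinearMap.mulLeft ℂ (MvPolynomial.X v) else (MvPolynomial.pderiv v).toLinearMap

theorem klein_pderiv (a : Fin n) (v : Cell n) (p : Fock n) :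
    klein a (MvPolynomial.pderiv v p) = kleinSign a v • MvPolynomial.pderiv v (klein a p) := by
  induction p using MvPolynomial.induction_on with
  | C c => simp [klein]
  | add p q hp hq => rw [map_add, map_add, hp, hq, map_add, map_add, smul_add]
  | mul_X p w hp =>
    simp only [Derivation.leibniz, map_add, map_mul, smul_eq_mul, klein_X, hp, Derivation.map_smul,
      MvPolynomial.pderiv_X]
    rcases eq_or_ne w v with rfl | h
    · simp only [Pi.single_eq_same, map_one, smul_add, mul_one, smul_mul_assoc, mul_smul_comm,
        smul_smul, kleinSign_mul_self, one_smul]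
    · simp only [Pi.single_eq_of_ne h, map_zero, smul_zero, mul_zero, zero_add, smul_mul_assoc,
        mul_smul_comm]

theorem klein_boson (a : Fin n) (v : Cell n) (ε : ℤˣ) (p : Fock n) :
    klein a (boson v ε p) = kleinSign a v • boson v ε (klein a p) := by
  unfold boson
  split_ifs
  · simp [klein_X]
  · exact klein_pderiv a v p

theorem boson_boson (v w : Cell n) (ξ η : ℤˣ) (p : Fock n) :
    boson v ξ (boson w η p) - boson w η (boson v ξ p) =
      (if v = w then (((η : ℤ) - (ξ : ℤ) : ℤ) : ℂ) / 2 else 0) • p := by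
  rcases Int.units_eq_one_or ξ with rfl | rfl <;> rcases Int.units_eq_one_or η with rfl | rfl
  · simp only [boson, if_true, LinearMap.mulLeft_apply]
    rw [mul_left_comm]
    simp
  · rcases eq_or_ne w v with rfl | h
    · simp [boson, Derivation.leibniz]
    · simp [boson, Derivation.leibniz, h.symm]
  · rcases eq_or_ne v w with rfl | h
    · simp [boson, Derivation.leibniz]
    · simp [boson, Derivation.leibniz, h]
  · have : MvPolynomial.pderiv v (MvPolynomial.pderiv w p) =
        MvPolynomial.pderiv w (MvPolynomial.pderiv v p) := by
      have h : ⁅MvPolynomial.pderiv (R := ℂ) v, MvPolynomial.pderiv (R := ℂ) w⁆ = 0 := by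
        ext u : 1
        simp [Derivation.commutator_apply, MvPolynomial.pderiv_X, Pi.single_apply]
        split_ifs <;> simp
      have h' := DFunLike.congr_fun h p
      rw [Derivation.commutator_apply] at h'
      exact sub_eq_zero.1 h'
    simp [boson, this]

/-- The components of Green's ansatz: bosons of different rows anticommute. -/
def green (a : Fin n) (g : Gen n) : Module.End ℂ (Fock n) :=
  boson (toLex (a, g.1)) g.2 * (klein a).toLinearMap

theorem green_apply (a : Fin n) (g : Gen n) (p : Fock n) :
    green a g p = boson (toLex (a, g.1)) g.2 (klein a p) := rfl

/-- For two different rows exactly one of the two Klein operators changes the sign of the other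
row's variables, whence anticommutation; within a row the Klein operator commutes with the bosons
and squares to 1. -/
theorem tripleRel_green : TripleRel fun g : Gen n => ∑ a, green a g := by
  refine tripleRel_sum _ (fun a i j ξ η => ?_) fun a b hab g h => ?_
  · refine LinearMap.ext fun p => ?_
    have hs : ∀ i : Fin n, kleinSign a (toLex (a, i)) = 1 := fun i => by simp [kleinSign]
    simp only [LinearMap.sub_apply, Module.End.mul_apply, green_apply, klein_boson, hs, one_smul,
      klein_self, boson_boson, LinearMap.smul_apply, Module.End.one_apply]
    simp
  · refine LinearMap.ext fun p => ?_
    simp only [LinearMap.neg_apply, Module.End.mul_apply, green_apply, klein_boson, map_smul]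
    have hc := boson_boson (toLex (a, g.1)) (toLex (b, h.1)) g.2 h.2 (klein a (klein b p))
    have hne : toLex (a, g.1) ≠ toLex (b, h.1) := fun e => hab (congrArg Prod.fst (toLex.injective e))
    rw [if_neg hne, zero_smul, sub_eq_zero] at hc
    rw [hc, klein_klein b a, ← neg_smul]
    congr 1
    rcases lt_or_gt_of_ne hab with hlt | hlt <;> simp [kleinSign, hlt, hlt.not_gt]

/-- The representation of the enveloping algebra on polynomials given by Green's ansatz. -/
def rep (n : ℕ) : Env n →ₐ[ℂ] Module.End ℂ (Fock n) := envLift (tripleRel_green (n := n))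

theorem rep_B (i : Fin n) : rep n (B i) = ∑ a, green a (i, 1) := envLift_B _ i

/-! ### Leading monomials of column operators -/

open MvPolynomial

/-- The sign with which the Klein operator of the row `a` acts on a monomial. -/
def kleinMon (a : Fin n) (m : Cell n →₀ ℕ) : ℂ := m.prod fun v k => kleinSign a v ^ k

theorem kleinMon_add (a : Fin n) (m m' : Cell n →₀ ℕ) :
    kleinMon a (m + m') = kleinMon a m * kleinMon a m' :=
  Finsupp.prod_add_index' (fun _ => pow_zero _) fun _ _ _ => pow_add _ _ _

theorem kleinMon_single (a : Fin n) (v : Cell n) :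
    kleinMon a (Finsupp.single v 1) = kleinSign a v := by
  simp [kleinMon]

theorem kleinMon_ne_zero (a : Fin n) (m : Cell n →₀ ℕ) : kleinMon a m ≠ 0 := by
  refine Finset.prod_ne_zero_iff.2 fun v _ => pow_ne_zero _ ?_
  unfold kleinSign
  split_ifs <;> norm_num

theorem klein_monomial (a : Fin n) (m : Cell n →₀ ℕ) (c : ℂ) :
    klein a (monomial m c) = kleinMon a m • monomial m c := by
  rw [klein, aeval_monomial, monomial_eq, kleinMon, Finsupp.prod, Finsupp.prod, Finsupp.prod,
    algebraMap_eq]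
  simp only [smul_pow]
  rw [← mul_smul_comm]
  congr 1
  exact Finset.prod_smul _ _ _

/-- The exponent of a product of variables. -/
def expo {k : ℕ} (a I : Fin k → Fin n) : Cell n →₀ ℕ :=
  ∑ r, Finsupp.single (toLex (a r, I r)) 1

/-- The sign that comes from the inversions of a sequence. -/
def invSign {k : ℕ} (a : Fin k → Fin n) : ℂ :=
  ∏ r, ∏ s ∈ Finset.Ioi r, if a s < a r then -1 else 1

theorem green_create_monomial (a i : Fin n) (m : Cell n →₀ ℕ) (c : ℂ) :
    green a (i, 1) (monomial m c) =
      monomial (Finsupp.single (toLex (a, i)) 1 + m) (kleinMon a m * c) := by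
  rw [green_apply, klein_monomial]
  simp only [boson, if_true, LinearMap.mulLeft_apply, MvPolynomial.X, smul_monomial,
    monomial_mul, smul_eq_mul, one_mul]

theorem kleinMon_expo (b : Fin n) {k : ℕ} (a I : Fin k → Fin n) :
    kleinMon b (expo a I) = ∏ r, if a r < b then -1 else 1 := by
  have : ∀ s : Finset (Fin k), kleinMon b (∑ r ∈ s, Finsupp.single (toLex (a r, I r)) 1) =
      ∏ r ∈ s, if a r < b then -1 else 1 := by
    intro s
    induction s using Finset.induction_on with
    | empty => simp [kleinMon]
    | insert r s hr ih =>
      rw [Finset.sum_insert hr, Finset.prod_insert hr, kleinMon_add, ih, kleinMon_single]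
      rfl
  exact this _

/-- Later factors act first, so the Klein operator of factor `r` sees the variables created by the
factors `s > r`; this produces `invSign a`. -/
theorem prod_green_monomial {k : ℕ} (a I : Fin k → Fin n) (m : Cell n →₀ ℕ) (c : ℂ) :
    (List.ofFn fun r => green (a r) (I r, 1)).prod (monomial m c) =
      monomial (expo a I + m) (invSign a * (∏ r, kleinMon (a r) m) * c) := by
  induction k with
  | zero => simp [expo, invSign]
  | succ k ih =>
    rw [List.ofFn_succ, List.prod_cons, Module.End.mul_apply,
      ih (fun r => a r.succ) (fun r => I r.succ), green_create_monomial]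
    have h1 : expo a I = Finsupp.single (toLex (a 0, I 0)) 1 +
        expo (fun r => a r.succ) (fun r => I r.succ) := Fin.sum_univ_succ _
    have h2 : invSign a = (∏ r : Fin k, if a r.succ < a 0 then -1 else 1) *
        invSign (fun r : Fin k => a r.succ) := by
      rw [invSign, Fin.prod_univ_succ, invSign]
      congr 1
      · rw [Fin.Ioi_zero_eq_map, Finset.prod_map]
        rfl
      · refine Finset.prod_congr rfl fun r _ => ?_
        rw [Fin.Ioi_succ, Finset.prod_map]
        rfl
    rw [h1, h2, Fin.prod_univ_succ, kleinMon_add, kleinMon_expo, add_assoc]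
    congr 1
    ring

/-- The coefficient of a row assignment in the action of a column operator, up to Klein signs. -/
def rowCoeff {k : ℕ} (a : Fin k → Fin n) : ℂ :=
  ∑ σ : Equiv.Perm (Fin k), (((Equiv.Perm.sign σ : ℤˣ) : ℤ) : ℂ) * invSign (a ∘ σ)

theorem antisymProd_green_monomial {k : ℕ} (a I : Fin k → Fin n) (m : Cell n →₀ ℕ) (c : ℂ) :
    antisymProd (Module.End ℂ (Fock n)) k (fun r => green (a r) (I r, 1)) (monomial m c) =
      monomial (expo a I + m) (rowCoeff a * (∏ r, kleinMon (a r) m) * c) := by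
  rw [antisymProd_apply, LinearMap.sum_apply, rowCoeff, Finset.sum_mul, Finset.sum_mul, map_sum]
  refine Finset.sum_congr rfl fun σ _ => ?_
  rw [LinearMap.smul_apply, prod_green_monomial (fun r => a (σ r)) (fun r => I (σ r)),
    smul_monomial]
  have h1 : expo (fun r => a (σ r)) (fun r => I (σ r)) = expo a I :=
    Equiv.sum_comp σ fun r => Finsupp.single (toLex (a r, I r)) 1
  have h2 : ∏ r, kleinMon (a (σ r)) m = ∏ r, kleinMon (a r) m :=
    Equiv.prod_comp σ fun r => kleinMon (a r) m
  rw [h1, h2, smul_eq_mul]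
  congr 1
  rw [← mul_assoc, ← mul_assoc]
  rfl

theorem rep_columnOp {k : ℕ} (I : Fin k → Fin n) :
    rep n (columnOp I) = ∑ a : Fin k → Fin n,
      antisymProd (Module.End ℂ (Fock n)) k fun r => green (a r) (I r, 1) := by
  have h1 : rep n (columnOp I) =
      antisymProd (Module.End ℂ (Fock n)) k fun r => ∑ a, green a (I r, 1) := by
    rw [columnOp, map_sum, antisymProd_apply]
    refine Finset.sum_congr rfl fun σ _ => ?_
    rw [map_smul, map_list_prod, List.map_ofFn]
    congr 3
    funext r
    exact rep_B _
  rw [h1]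
  exact MultilinearMap.map_sum
    (antisymProd (Module.End ℂ (Fock n)) k).toMultilinearMap fun r a => green a (I r, 1)

theorem rep_columnOp_monomial {k : ℕ} (I : Fin k → Fin n) (m : Cell n →₀ ℕ) (c : ℂ) :
    rep n (columnOp I) (monomial m c) = ∑ a : Fin k → Fin n,
      monomial (expo a I + m) (rowCoeff a * (∏ r, kleinMon (a r) m) * c) := by
  rw [rep_columnOp, LinearMap.sum_apply]
  exact Finset.sum_congr rfl fun a _ => antisymProd_green_monomial a I m c

/-- A transposition of two positions in the same row leaves `a` fixed and reverses the sign. -/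
theorem rowCoeff_of_not_injective {k : ℕ} {a : Fin k → Fin n} (ha : ¬ Function.Injective a) :
    rowCoeff a = 0 := by
  simp only [Function.Injective, not_forall] at ha
  obtain ⟨r, s, h, hrs⟩ := ha
  have hsw : a ∘ Equiv.swap r s = a := by
    funext t
    simp only [Function.comp_apply, Equiv.swap_apply_def]
    split_ifs with h1 h2
    · rw [h1, h]
    · rw [h2, h]
    · rfl
  have h2 : rowCoeff a = -rowCoeff a := by
    conv_lhs => rw [rowCoeff, ← Equiv.sum_comp (Equiv.mulLeft (Equiv.swap r s))]
    rw [rowCoeff, ← Finset.sum_neg_distrib]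
    refine Finset.sum_congr rfl fun σ _ => ?_
    rw [Equiv.coe_mulLeft, Equiv.Perm.sign_mul, Equiv.Perm.sign_swap hrs, Equiv.Perm.coe_mul,
      ← Function.comp_assoc, hsw]
    simp
  linear_combination h2 / 2

/-- Here `invSign (a ∘ σ)` is the sign of `σ`, so it cancels the antisymmetrizer's sign and nothing
is lost. -/
theorem rowCoeff_of_strictMono {k : ℕ} {a : Fin k → Fin n} (ha : StrictMono a) :
    rowCoeff a = k.factorial := by
  have h : ∀ σ : Equiv.Perm (Fin k),
      (((Equiv.Perm.sign σ : ℤˣ) : ℤ) : ℂ) * invSign (a ∘ σ) = 1 := by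
    intro σ
    have h1 : invSign (a ∘ σ) = (((Equiv.Perm.sign σ : ℤˣ) : ℤ) : ℂ) := by
      rw [Equiv.Perm.sign_eq_prod_prod_Ioi, invSign]
      push_cast
      refine Finset.prod_congr rfl fun r _ => Finset.prod_congr rfl fun s hs => ?_
      have hne : σ r ≠ σ s := fun e => (Finset.mem_Ioi.1 hs).ne (σ.injective e)
      simp only [Function.comp_apply, ha.lt_iff_lt]
      rcases lt_or_gt_of_ne hne with hlt | hlt <;> simp [hlt, hlt.not_gt]
    rw [h1, ← Int.cast_mul, ← Units.val_mul, Int.units_mul_self]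
    simp
  rw [rowCoeff, Finset.sum_congr rfl fun σ _ => h σ]
  simp [Fintype.card_perm]

theorem expo_apply {k : ℕ} (a I : Fin k → Fin n) (b i : Fin n) :
    expo a I (toLex (b, i)) = ∑ r, if a r = b ∧ I r = i then 1 else 0 := by
  rw [expo, Finsupp.finsetSum_apply]
  refine Finset.sum_congr rfl fun r _ => ?_
  rw [Finsupp.single_apply]
  simp only [EmbeddingLike.apply_eq_iff_eq, Prod.mk.injEq]

/-- Let `r` be the first index that `a` moves. Rows before `r` agree; any letter that `a` puts in
row `r` has a later index, hence exceeds `I r`. So the first difference is at `(r, I r)`, where only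
the right side has the variable. -/
theorem expo_lt {k : ℕ} (hk : k ≤ n) {a I : Fin k → Fin n} (hI : StrictMono I)
    (ha : Function.Injective a) (hne : a ≠ Fin.castLE hk) :
    toLex (expo a I) < toLex (expo (Fin.castLE hk) I) := by
  have hex : ∃ r, a r ≠ Fin.castLE hk r := Function.ne_iff.1 hne
  obtain ⟨r, hr, hmin⟩ : ∃ r, a r ≠ Fin.castLE hk r ∧ ∀ s < r, a s = Fin.castLE hk s := by
    have hwf := (wellFounded_lt (α := Fin k)).has_min {r | a r ≠ Fin.castLE hk r} hex
    obtain ⟨r, hr, h⟩ := hwf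
    exact ⟨r, hr, fun s hs => by_contra fun h' => h s h' hs⟩
  rw [Finsupp.Lex.lt_iff]
  have key : ∀ s, a s = Fin.castLE hk r → r < s := by
    intro s hs
    rcases lt_trichotomy s r with h | h | h
    · rw [hmin s h] at hs
      exact absurd (Fin.castLE_injective hk hs) h.ne
    · rw [h] at hs
      exact absurd hs hr
    · exact h
  refine ⟨toLex (Fin.castLE hk r, I r), ?_, ?_⟩
  · intro v hv
    obtain ⟨⟨b, i⟩, rfl⟩ := toLex.surjective v
    change expo a I _ = expo _ I _
    rw [expo_apply, expo_apply]
    refine Finset.sum_congr rfl fun s _ => ?_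
    rw [Prod.Lex.toLex_lt_toLex] at hv
    refine if_congr ?_ rfl rfl
    rcases hv with hv | ⟨hv1, hv2⟩
    · simp only at hv
      constructor
      · rintro ⟨rfl, rfl⟩
        refine ⟨?_, rfl⟩
        by_contra h
        have hrs : r ≤ s := le_of_not_gt fun hlt => h (hmin s hlt).symm
        have hb : ((a s : Fin n) : ℕ) < r := hv
        have h2 := hmin ⟨a s, hb.trans r.2⟩ hb
        have h3 : (⟨a s, hb.trans r.2⟩ : Fin k) = s := ha (by rw [h2]; rfl)
        have h4 := congrArg Fin.val h3
        simp only at h4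
        have := Fin.le_def.1 hrs
        omega
      · rintro ⟨rfl, rfl⟩
        have : s < r := hv
        exact ⟨hmin s this, rfl⟩
    · simp only at hv1 hv2
      subst hv1
      constructor
      · rintro ⟨h1, rfl⟩
        exact absurd (hI (key s h1)) hv2.not_gt
      · rintro ⟨h1, rfl⟩
        rw [Fin.castLE_injective hk h1] at hv2
        exact absurd hv2 (lt_irrefl _)
  · change expo a I _ < expo _ I _
    rw [expo_apply, expo_apply]
    have h0 : (∑ s, if a s = Fin.castLE hk r ∧ I s = I r then 1 else 0) = 0 := by
      refine Finset.sum_eq_zero fun s _ => if_neg ?_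
      rintro ⟨h1, h2⟩
      exact (key s h1).ne (hI.injective h2).symm
    rw [h0]
    refine Finset.sum_pos' (fun _ _ => Nat.zero_le _) ⟨r, Finset.mem_univ _, ?_⟩
    simp

/-- The polynomials all of whose monomials are smaller than a given one. -/
def below (m : Cell n →₀ ℕ) : Submodule ℂ (Fock n) :=
  Submodule.span ℂ {p | ∃ m' c, toLex m' < toLex m ∧ p = monomial m' c}

theorem monomial_mem_below {m m' : Cell n →₀ ℕ} (h : toLex m' < toLex m) (c : ℂ) :
    monomial m' c ∈ below m := Submodule.subset_span ⟨m', c, h, rfl⟩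

theorem coeff_eq_zero_of_mem_below {m m' : Cell n →₀ ℕ} (h : toLex m ≤ toLex m') {p : Fock n}
    (hp : p ∈ below m) : coeff m' p = 0 := by
  induction hp using Submodule.span_induction with
  | mem p hp =>
    obtain ⟨m'', c, hlt, rfl⟩ := hp
    rw [coeff_monomial, if_neg]
    rintro rfl
    exact absurd hlt h.not_gt
  | zero => simp
  | add p q _ _ hp hq => simp [hp, hq]
  | smul c p _ hp => simp [hp]

/-- The polynomial `p` has the leading monomial `m`. -/
def HasLead (p : Fock n) (m : Cell n →₀ ℕ) : Prop :=
  ∃ c : ℂ, c ≠ 0 ∧ p - monomial m c ∈ below m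

/-- The order is compatible with addition of exponents, so the leading monomial of the column
multiplies that of `p`. The coefficient is `k!` times nonzero Klein signs. -/
theorem HasLead.rep_columnOp {p : Fock n} {m : Cell n →₀ ℕ} (hp : HasLead p m) {k : ℕ}
    (hk : k ≤ n) {I : Fin k → Fin n} (hI : StrictMono I) :
    HasLead (rep n (columnOp I) p) (expo (Fin.castLE hk) I + m) := by
  obtain ⟨c, hc, hpm⟩ := hp
  have hlt : ∀ (a : Fin k → Fin n) (m' : Cell n →₀ ℕ) (c : ℂ), toLex m' ≤ toLex m →
      (a ≠ Fin.castLE hk ∨ toLex m' < toLex m) →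
      monomial (expo a I + m') (rowCoeff a * (∏ r, kleinMon (a r) m') * c) ∈
        below (expo (Fin.castLE hk) I + m) := by
    intro a m' c hle h
    by_cases ha : Function.Injective a
    · refine monomial_mem_below ?_ _
      rw [toLex_add, toLex_add]
      rcases eq_or_ne a (Fin.castLE hk) with rfl | hne
      · exact add_lt_add_right (h.resolve_left fun h => h rfl) _
      · exact add_lt_add_of_lt_of_le (expo_lt hk hI ha hne) hle
    · rw [rowCoeff_of_not_injective ha, zero_mul, zero_mul, map_zero]
      exact zero_mem _
  refine ⟨rowCoeff (Fin.castLE hk) * (∏ r, kleinMon (Fin.castLE hk r) m) * c, ?_, ?_⟩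
  · rw [rowCoeff_of_strictMono (Fin.strictMono_castLE hk)]
    exact mul_ne_zero (mul_ne_zero (Nat.cast_ne_zero.2 (Nat.factorial_ne_zero _))
      (Finset.prod_ne_zero_iff.2 fun _ _ => kleinMon_ne_zero _ _)) hc
  · have h1 : below m ≤ (below (expo (Fin.castLE hk) I + m)).comap (rep n (columnOp I)) := by
      refine Submodule.span_le.2 ?_
      rintro _ ⟨m', c, hm', rfl⟩
      change rep n (columnOp I) (monomial m' c) ∈ below _
      rw [rep_columnOp_monomial]
      exact sum_mem fun a _ => hlt a m' c hm'.le (Or.inr hm')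
    have h2 : rep n (columnOp I) (p - monomial m c) ∈ below (expo (Fin.castLE hk) I + m) := h1 hpm
    have h3 : rep n (columnOp I) (monomial m c) - monomial (expo (Fin.castLE hk) I + m)
        (rowCoeff (Fin.castLE hk) * (∏ r, kleinMon (Fin.castLE hk r) m) * c) ∈
        below (expo (Fin.castLE hk) I + m) := by
      rw [rep_columnOp_monomial, ← Finset.add_sum_erase _ _ (Finset.mem_univ (Fin.castLE hk)),
        add_sub_cancel_left]
      exact sum_mem fun a ha => hlt a m c le_rfl (Or.inl (Finset.ne_of_mem_erase ha))
    have h4 := add_mem h2 h3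
    rwa [map_sub, sub_add_sub_cancel] at h4

theorem linearIndependent_of_hasLead {α : Type*} (v : α → Fock n) (l : α → Cell n →₀ ℕ)
    (hl : Function.Injective l) (h : ∀ A, HasLead (v A) (l A)) : LinearIndependent ℂ v := by
  rw [linearIndependent_iff']
  intro s g hg
  by_contra! hne
  obtain ⟨A₀, hA₀, hg₀⟩ := hne
  classical
  obtain ⟨A, hA, hmax⟩ := (s.filter (g · ≠ 0)).exists_max_image (fun A => toLex (l A))
    ⟨A₀, Finset.mem_filter.2 ⟨hA₀, hg₀⟩⟩
  rw [Finset.mem_filter] at hA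
  have h0 := congrArg (coeff (l A)) hg
  rw [coeff_sum, Finset.sum_eq_single A] at h0
  · obtain ⟨c, hc, hv⟩ := h A
    have h1 := coeff_eq_zero_of_mem_below le_rfl hv
    rw [coeff_sub, coeff_monomial, if_pos rfl, sub_eq_zero] at h1
    rw [coeff_smul, h1, coeff_zero, smul_eq_mul] at h0
    exact (mul_ne_zero hA.2 hc) h0
  · intro A' hA' hne
    by_cases hg' : g A' = 0
    · simp [hg']
    · have hle := hmax A' (Finset.mem_filter.2 ⟨hA', hg'⟩)
      obtain ⟨c, _, hv⟩ := h A'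
      have h1 := coeff_eq_zero_of_mem_below hle hv
      rw [coeff_sub, coeff_monomial, if_neg (fun e => hne (hl e)), sub_zero] at h1
      rw [coeff_smul, h1, smul_zero]
  · intro h; exact absurd hA.1 h

end Osp

/-! ### Row contents and linear independence -/

namespace Tableau

open Osp MvPolynomial

variable {n : ℕ}

theorem column_strictMono (A : Tableau n) (l : ℕ) : StrictMono (A.column l) := fun _ s h =>
  Fin.lt_def.2 (A.filling.col_strict (Fin.lt_def.1 h) (YoungDiagram.mem_iff_lt_colLen.2 s.2))

theorem colLen_le (A : Tableau n) (l : ℕ) : A.shape.colLen l ≤ n := by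
  simpa using Fintype.card_le_of_injective _ (A.column_strictMono l).injective

theorem lt_of_mem_shape {A : Tableau n} {i j : ℕ} (h : (i, j) ∈ A.shape) :
    i < n ∧ j < A.numCols := by
  refine ⟨(YoungDiagram.mem_iff_lt_colLen.1 h).trans_le (A.colLen_le j), ?_⟩
  exact YoungDiagram.mem_iff_lt_rowLen.1 (A.shape.up_left_mem (Nat.zero_le i) le_rfl h)

/-- The exponent that records how often each letter occurs in each row. -/
def rowContent (A : Tableau n) : Cell n →₀ ℕ :=
  ∑ l ∈ Finset.range A.numCols, expo (Fin.castLE (A.colLen_le l)) (A.column l)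

theorem hasLead_rep_op (A : Tableau n) : HasLead (rep n A.op 1) A.rowContent := by
  have h : ∀ m : ℕ, HasLead (rep n ((List.range m).reverse.map fun l =>
      columnOp (A.column l)).prod 1)
      (∑ l ∈ Finset.range m, expo (Fin.castLE (A.colLen_le l)) (A.column l)) := by
    intro m
    induction m with
    | zero =>
      refine ⟨1, one_ne_zero, ?_⟩
      simp
    | succ m ih =>
      rw [List.range_succ, List.reverse_append, Finset.sum_range_succ, add_comm]
      simp only [List.reverse_singleton, List.singleton_append, List.map_cons, List.prod_cons,
        map_mul, Module.End.mul_apply]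
      exact ih.rep_columnOp _ (A.column_strictMono m)
  exact h A.numCols

theorem sum_rowContent (A : Tableau n) (a x : Fin n) :
    ∑ i ∈ Finset.Iic x, A.rowContent (toLex (a, i)) =
      ((Finset.range A.numCols).filter fun l : ℕ =>
        ((a : ℕ), l) ∈ A.shape ∧ A.filling a l ≤ x).card := by
  have h : ∀ l, ∑ i ∈ Finset.Iic x,
      expo (Fin.castLE (A.colLen_le l)) (A.column l) (toLex (a, i)) =
        if ((a : ℕ), l) ∈ A.shape ∧ A.filling a l ≤ x then 1 else 0 := by
    intro l
    simp only [expo_apply]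
    rw [Finset.sum_comm]
    by_cases ha : ((a : ℕ), l) ∈ A.shape
    · rw [Finset.sum_eq_single ⟨a, YoungDiagram.mem_iff_lt_colLen.1 ha⟩]
      · have e : Fin.castLE (A.colLen_le l) ⟨a, YoungDiagram.mem_iff_lt_colLen.1 ha⟩ = a := rfl
        simp only [e, true_and, ha]
        rw [Finset.sum_ite_eq]
        exact if_congr (by rw [Finset.mem_Iic, Fin.le_def]; rfl) rfl rfl
      · intro r _ hr
        refine Finset.sum_eq_zero fun i _ => if_neg fun h => hr ?_
        have e := congrArg Fin.val h.1
        exact Fin.ext e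
      · simp
    · rw [if_neg fun h => ha h.1]
      refine Finset.sum_eq_zero fun r _ => Finset.sum_eq_zero fun i _ => if_neg fun h => ha ?_
      rw [YoungDiagram.mem_iff_lt_colLen, ← h.1]
      exact r.2
  simp only [rowContent, Finsupp.finsetSum_apply]
  rw [Finset.sum_comm, Finset.sum_congr rfl fun l _ => h l, Finset.card_filter]

/-- Rows increase weakly, so the entries `≤ x` fill an initial segment, whose length is the partial
sum of the row content. -/
theorem mem_shape_and_le_iff (A : Tableau n) (a x : Fin n) (l : ℕ) :
    (((a : ℕ), l) ∈ A.shape ∧ A.filling a l ≤ x) ↔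
      l < ∑ i ∈ Finset.Iic x, A.rowContent (toLex (a, i)) := by
  rw [sum_rowContent]
  set S := (Finset.range A.numCols).filter fun l : ℕ =>
        ((a : ℕ), l) ∈ A.shape ∧ A.filling a l ≤ x with hS
  have hmem : ∀ l, l ∈ S ↔ ((a : ℕ), l) ∈ A.shape ∧ A.filling a l ≤ x := by
    intro l
    rw [hS, Finset.mem_filter, Finset.mem_range]
    exact ⟨fun h => h.2, fun h => ⟨(lt_of_mem_shape h.1).2, h⟩⟩
  have hlow : ∀ l ∈ S, ∀ l' ≤ l, l' ∈ S := by
    intro l hl l' hle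
    rw [hmem] at hl ⊢
    refine ⟨A.shape.up_left_mem le_rfl hle hl.1, ?_⟩
    rcases hle.eq_or_lt with rfl | hlt
    · exact hl.2
    · exact (A.filling.row_weak hlt hl.1).trans hl.2
  rw [← hmem]
  constructor
  · intro hl
    have : Finset.range (l + 1) ⊆ S := fun l' hl' =>
      hlow l hl l' (Nat.lt_succ_iff.1 (Finset.mem_range.1 hl'))
    simpa using Finset.card_le_card this
  · intro hl
    by_contra hlS
    have : S ⊆ Finset.range l := fun l' hl' => Finset.mem_range.2 <| by
      by_contra! hle
      exact hlS (hlow l' hl' l hle)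
    have := Finset.card_le_card this
    rw [Finset.card_range] at this
    omega

theorem ext_of_shape_of_filling {A A' : Tableau n} (h : A.shape = A'.shape)
    (h' : ∀ i j, (i, j) ∈ A.shape → A.filling i j = A'.filling i j) : A = A' := by
  obtain ⟨μ, T, hT⟩ := A
  obtain ⟨μ', T', hT'⟩ := A'
  obtain rfl : μ = μ' := h
  have : T = T' := by
    ext i j
    by_cases hij : (i, j) ∈ μ
    · exact h' i j hij
    · rw [T.zeros hij, T'.zeros hij]
  subst this
  rfl

theorem rowContent_injective : Function.Injective (rowContent (n := n)) := by
  intro A A' h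
  have hiff : ∀ (a x : Fin n) (l : ℕ), (((a : ℕ), l) ∈ A.shape ∧ A.filling a l ≤ x) ↔
      (((a : ℕ), l) ∈ A'.shape ∧ A'.filling a l ≤ x) := by
    intro a x l
    rw [mem_shape_and_le_iff, mem_shape_and_le_iff, h]
  have key : ∀ {A A' : Tableau n}, (∀ (a x : Fin n) (l : ℕ),
      (((a : ℕ), l) ∈ A.shape ∧ A.filling a l ≤ x) ↔
      (((a : ℕ), l) ∈ A'.shape ∧ A'.filling a l ≤ x)) → ∀ i j, (i, j) ∈ A.shape →
      (i, j) ∈ A'.shape ∧ A'.filling i j ≤ A.filling i j := by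
    intro A A' hiff i j hij
    exact (hiff ⟨i, (lt_of_mem_shape hij).1⟩ ⟨_, A.entry_lt i j hij⟩ j).1 ⟨hij, le_rfl⟩
  have h1 := key hiff
  have h2 := key fun a x l => (hiff a x l).symm
  refine ext_of_shape_of_filling ?_ ?_
  · ext ⟨i, j⟩
    exact ⟨fun hij => (h1 i j hij).1, fun hij => (h2 i j hij).1⟩
  · intro i j hij
    exact le_antisymm (h2 i j (h1 i j hij).1).2 (h1 i j hij).2

/-- Independence is tested after acting on the polynomial 1. -/
theorem linearIndependent_op : LinearIndependent ℂ (op (n := n)) :=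
  LinearIndependent.of_comp ((LinearMap.applyₗ (1 : Fock n)) ∘ₗ (rep n).toLinearMap)
    (linearIndependent_of_hasLead _ _ rowContent_injective hasLead_rep_op)

end Tableau
end

theorem corollary5p6 (n : ℕ) :
    ∃ b : Module.Basis (Tableau n) ℂ (Osp.Env n), ∀ A : Tableau n, b A = A.op :=
  ⟨Module.Basis.mk Tableau.linearIndependent_op (Osp.span_range_op n).ge,
    fun A => Module.Basis.mk_apply _ _ A⟩
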